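/- **Setting.** Let $(\Omega,\mathcal F)$ be a measurable space and $\mathscr H$ a linear space of $\mathcal F$-measurable real functions on $\Omega$ such that $\varphi(Y_1,\dots,Y_n)\in\mathscr H$ whenever $Y_1,\dots,Y_n\in\mathscr H$ and $\varphi:\mathbb R^n\to\mathbb R$ satisfies $|\varphi(x)-\varphi(y)|\le C(1+|x|^m+|y|^m)|x-y|$ for some $C>0$, $m\in\mathbb N$. Let $\hat{\mathbb E}:\mathscr H\to[-\infty,\infty]$ be a sub-linear expectation: it is monotone, $\hat{\mathbb E}[c]=c$ for constants $c$, $\hat{\mathbb E}[X+Y]\le\hat{\mathbb E}[X]+\hat{\mathbb E}[Y]$ whenever the right side is not of the form $\infty-\infty$ or $-\infty+\infty$, and $\hat{\mathbb E}[\lambda X]=\lambda\hat{\mathbb E}[X]$ for $\lambda\ge0$. Let $\mathscr H_b$ be the set of bounded elements of $\mathscr H$, and put $$\widehat{\mathbb V}(A)=\inf\{\hat{\mathbb E}[\xi]: I_A\le\xi,\ \xi\in\mathscr H\},\qquad \widehat{\mathbb V}^*(A)=\inf\Big\{\sum_{n=1}^\infty\widehat{\mathbb V}(A_n): A\subset\bigcup_{n=1}^\infty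 A_n,\ A_n\in\mathcal F\Big\}.$$ Condition (CC): $\mathscr P$ is a family of probability measures on $(\Omega,\sigma(\mathscr H))$ such that $\hat{\mathbb E}[X]=\sup_{P\in\mathscr P}E_P[X]$ for all $X\in\mathscr H_b$, and such that for all $Y_1,Y_2,\dots\in\mathscr H_b$ the family of laws of $(Y_1,Y_2,\dots)$ on $\mathbb R^{\mathbb N}$ under the $P\in\mathscr P$ is weakly compact. Let $X_1,X_2,\dots\in\mathscr H$ be i.i.d. under $\hat{\mathbb E}$, that is, for all bounded Lipschitz $\varphi$: $\hat{\mathbb E}[\varphi(X_i)]=\hat{\mathbb E}[\varphi(X_1)]$, and $\hat{\mathbb E}[\varphi(X_1,\dots,X_{i+1})]=\hat{\mathbb E}\big[\hat{\mathbb E}[\varphi(x_1,\dots,x_i,X_{i+1})]\big|_{x_1=X_1,\dots,x_i=X_i}\big]$ for every $i\ge1$. Assume that the Choquet integral $C_{\widehat{\mathbb V}}(|X_1|)=\int_0^\infty\widehat{\mathbb V}(|X_1|\ge t)\,dt$ is finite. Put $\boldsymbol X=(X_1,X_2,\dots)$, $S_n=X_1+\dots+X_n$, $\overline\mu=\lim_{c\to\infty}\hat{\mathbb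 E}[(-c)\vee X_1\wedge c]$ and $\underline\mu=-\lim_{c\to\infty}\hat{\mathbb E}[(-c)\vee(-X_1)\wedge c]$, and let $C\{x_n\}$ denote the cluster set in $\mathbb R$ of a real sequence $(x_n)$. Let $\mathbb L_c$ be the set of Borel functions $\varphi:\mathbb R^{\mathbb N}\to\mathbb R$ such that for every $\epsilon>0$ there is a bounded continuous $\psi:\mathbb R^{\mathbb N}\to\mathbb R$ with $\sup_{P\in\mathscr P}E_P[|\varphi(\boldsymbol X)-\psi(\boldsymbol X)|]\le\epsilon$. **Theorem.** Under condition (CC): (a) For all $d$ and all Borel functions $\underline\varphi,\overline\varphi:\mathbb R^d\to\mathbb R$ with $\underline\mu\le\underline\varphi\le\overline\varphi\le\overline\mu$ everywhere, there is a probability measure $Q$ on $(\Omega,\sigma(\mathscr H))$ such that $E_Q[X]\le\hat{\mathbb E}[X]$ for all $X\in\mathscr H_b$ and $$\widehat{\mathbb V}^*\Big(C\Big\{\frac{S_n}n\Big\}=\big[\underline\varphi(X_1,\dots,X_d),\overline\varphi(X_1,\dots,X_d)\big]\Big)=Q\Big(C\Big\{\frac{S_n}n\Big\}=\big[\underline\varphi(X_1,\dots,X_d),\overline\varphi(X_1,\dots,X_d)\big]\Big)=1.$$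 (b) For all $\underline\varphi,\overline\varphi\in\mathbb L_c$ with $\underline\mu\le\underline\varphi\le\overline\varphi\le\overline\mu$ everywhere, there is $P\in\mathscr P$ such that $$\widehat{\mathbb V}^*\Big(C\Big\{\frac{S_n}n\Big\}=\big[\underline\varphi(\boldsymbol X),\overline\varphi(\boldsymbol X)\big]\Big)=P\Big(C\Big\{\frac{S_n}n\Big\}=\big[\underline\varphi(\boldsymbol X),\overline\varphi(\boldsymbol X)\big]\Big)=1.$$ -/

import Mathlib

open MeasureTheory Filter Topology
open scoped ENNReal BoundedContinuousFunction

/-- The class `C_{l,Lip}(ℝⁿ)` of locally Lipschitz functions of polynomial growth. -/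
def IsLocLip {n : ℕ} (φ : (Fin n → ℝ) → ℝ) : Prop :=
  ∃ C : ℝ, 0 < C ∧ ∃ m : ℕ, ∀ x y : Fin n → ℝ,
    |φ x - φ y| ≤ C * (1 + ‖x‖ ^ m + ‖y‖ ^ m) * ‖x - y‖

/-- Bounded Lipschitz functions; for `α = ℝⁿ` this is `C_{b,Lip}(ℝⁿ)`. -/
def IsBddLip {α : Type*} [PseudoMetricSpace α] (φ : α → ℝ) : Prop :=
  (∃ K, LipschitzWith K φ) ∧ ∃ M : ℝ, ∀ x, |φ x| ≤ M

/-- A sub-linear expectation space `(Ω, H, E)` over a measurable space `(Ω, 𝓕)`.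
The expectation is a function on `H`: it is represented by a function on all of `Ω → ℝ` whose
values outside `H` are irrelevant (no axiom and no definition below reads them). -/
structure SublinearExpectation (Ω : Type*) [MeasurableSpace Ω] where
  /-- the linear space of random variables -/
  H : Submodule ℝ (Ω → ℝ)
  measurable_of_mem : ∀ X ∈ H, Measurable X
  comp_mem : ∀ (n : ℕ) (φ : (Fin n → ℝ) → ℝ), IsLocLip φ →
    ∀ X : Fin n → Ω → ℝ, (∀ i, X i ∈ H) → (fun ω => φ (fun i => X i ω)) ∈ H
  /-- the sub-linear expectation -/
  E : (Ω → ℝ) → EReal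
  mono : ∀ X ∈ H, ∀ Y ∈ H, (∀ ω, Y ω ≤ X ω) → E Y ≤ E X
  const : ∀ c : ℝ, E (fun _ => c) = (c : EReal)
  subadd : ∀ X ∈ H, ∀ Y ∈ H, ¬ (E X = ⊤ ∧ E Y = ⊥) → ¬ (E X = ⊥ ∧ E Y = ⊤) →
    E (fun ω => X ω + Y ω) ≤ E X + E Y
  pos_homog : ∀ X ∈ H, ∀ r : ℝ, 0 ≤ r → E (fun ω => r * X ω) = (r : EReal) * E X

namespace SublinearExpectation

variable {Ω : Type*} [MeasurableSpace Ω] (S : SublinearExpectation Ω)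

/-- `σ(H)`, the σ-algebra on `Ω` generated by the random variables in `H`. -/
abbrev sigma : MeasurableSpace Ω := ⨆ X ∈ S.H, MeasurableSpace.comap X (borel ℝ)

/-- `H_b`, the bounded elements of `H`. -/
def Hb : Set (Ω → ℝ) := {X | X ∈ S.H ∧ ∃ M : ℝ, ∀ ω, |X ω| ≤ M}

/-- Probability measures on `(Ω, σ(H))`. -/
abbrev Prob : Type _ := @ProbabilityMeasure Ω S.sigma

/-- The upper capacity `V(A) = inf {E[ξ] : 1_A ≤ ξ, ξ ∈ H}`. Every `ξ` that occurs is nonnegative,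
so `E[ξ] ≥ 0` and nothing is lost by taking values in `[0, ∞]`; moreover `V(A) ≤ E[1] = 1`. -/
noncomputable def upperCapacity (A : Set Ω) : ℝ≥0∞ :=
  ⨅ (ξ : Ω → ℝ) (_ : ξ ∈ S.H) (_ : ∀ ω, A.indicator (fun _ => (1 : ℝ)) ω ≤ ξ ω), (S.E ξ).toENNReal

/-- The countably sub-additive extension `V*` of the upper capacity. -/
noncomputable def outerCapacity (A : Set Ω) : ℝ≥0∞ :=
  ⨅ (B : ℕ → Set Ω) (_ : ∀ n, MeasurableSet (B n)) (_ : A ⊆ ⋃ n, B n), ∑' n, S.upperCapacity (B n)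

/-- The Choquet expectation
`C_V[X] = ∫_0^∞ V(X ≥ t) dt + ∫_{-∞}^0 (V(X ≥ t) - 1) dt` for the upper capacity `V ≤ 1`. -/
noncomputable def choquet (X : Ω → ℝ) : EReal :=
  ((∫⁻ t in Set.Ioi (0 : ℝ), S.upperCapacity {ω | t ≤ X ω} : ℝ≥0∞) : EReal)
    - ((∫⁻ t in Set.Iio (0 : ℝ), (1 - S.upperCapacity {ω | t ≤ X ω}) : ℝ≥0∞) : EReal)

/-- The extended upper mean `lim_{c → ∞} E[(-c) ∨ X ∧ c]`. -/
noncomputable def upperMean (X : Ω → ℝ) : EReal :=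
  limUnder atTop (fun c : ℝ => S.E (fun ω => max (-c) (min (X ω) c)))

/-- The conjugate of the extended upper mean. -/
noncomputable def lowerMean (X : Ω → ℝ) : EReal := -S.upperMean (fun ω => -X ω)

/-- `X` and `Y` are identically distributed. -/
def IdentDistrib (X Y : Ω → ℝ) : Prop :=
  ∀ φ : ℝ → ℝ, IsBddLip φ → S.E (fun ω => φ (X ω)) = S.E (fun ω => φ (Y ω))

/-- `Y` is independent to the random vector `X = (X₁, …, X_m)`:
`E[φ(X, Y)] = E[E[φ(x, Y)]|_{x = X}]`. The inner expectation, of a bounded variable, is finite. -/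
def IndepTo {m : ℕ} (Y : Ω → ℝ) (X : Fin m → Ω → ℝ) : Prop :=
  ∀ φ : (Fin m → ℝ) × ℝ → ℝ, IsBddLip φ →
    S.E (fun ω => φ (fun i => X i ω, Y ω)) =
      S.E (fun ω => (S.E (fun ω' => φ (fun i => X i ω, Y ω'))).toReal)

/-- A sequence `X 0, X 1, …` of i.i.d. random variables of the sub-linear expectation space. -/
structure IsIID (X : ℕ → Ω → ℝ) : Prop where
  mem : ∀ i, X i ∈ S.H
  identDistrib : ∀ i, S.IdentDistrib (X i) (X 0)
  indep : ∀ i, S.IndepTo (X (i + 1)) (fun j : Fin (i + 1) => X j)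

/-- The laws on `ℝ^ℕ` of the sequence `Y` under the members of `Ps`. -/
def laws (Ps : Set S.Prob) (Y : ℕ → Ω → ℝ) : Set (ProbabilityMeasure (ℕ → ℝ)) :=
  {ν | ∃ P ∈ Ps, ∀ A : Set (ℕ → ℝ), MeasurableSet A →
    (ν : Measure (ℕ → ℝ)) A = (P : @Measure Ω S.sigma) {ω | (fun i => Y i ω) ∈ A}}

/-- Condition (CC): on `H_b`, `E` is the upper expectation of the family `Ps`, which is
countable-dimensionally weakly compact. -/
structure ConditionCC (Ps : Set S.Prob) : Prop where
  eq_sup : ∀ X ∈ S.Hb,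
    S.E X = ⨆ P ∈ Ps, ((∫ ω, X ω ∂(P : @Measure Ω S.sigma) : ℝ) : EReal)
  compact : ∀ Y : ℕ → Ω → ℝ, (∀ i, Y i ∈ S.Hb) → IsCompact (S.laws Ps Y)

/-- The set of probability measures on `σ(H)` dominated by `E` on `H_b`. -/
def maxFamily : Set S.Prob :=
  {Q | ∀ X ∈ S.Hb, ((∫ ω, X ω ∂(Q : @Measure Ω S.sigma) : ℝ) : EReal) ≤ S.E X}

/-- The space `𝕃_c`: the Borel functions on `ℝ^ℕ` in the completion of `C_b(ℝ^ℕ)` under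
`φ ↦ sup_{P ∈ Ps} E_P[|φ(X₁, X₂, …)|]`. -/
def Lc (Ps : Set S.Prob) (X : ℕ → Ω → ℝ) : Set ((ℕ → ℝ) → ℝ) :=
  {φ | Measurable φ ∧ ∀ ε : ℝ≥0∞, 0 < ε → ∃ ψ : (ℕ → ℝ) →ᵇ ℝ,
    (⨆ P ∈ Ps, ∫⁻ ω, ENNReal.ofReal |φ (fun i => X i ω) - ψ (fun i => X i ω)|
      ∂(P : @Measure Ω S.sigma)) ≤ ε}

end SublinearExpectation

/-- The cluster set of a real sequence: the limits in `ℝ` of its subsequences. -/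
def clusterSet (x : ℕ → ℝ) : Set ℝ := {a | MapClusterPt a atTop x}

/-- The averages `S_n / n`, where `S_n` is the sum of the first `n` terms. -/
noncomputable def runningAverage (x : ℕ → ℝ) (n : ℕ) : ℝ := (∑ i ∈ Finset.range n, x i) / n

/-! Under (CC), `E` is on bounded functions of `(X₁, X₂, …)` the upper expectation of a weakly
compact set of laws on `ℝ^ℕ`. Divide time into rapidly growing blocks and prescribe for each block a
mean between the lower and the upper mean of `X₁`, depending on the past. Given the past, the block
may be replaced by an i.i.d. sample from a law dominated by `X₁`, and the means of these laws are
dense between the two extremes; so by the law of large numbers some such law makes it unlikely that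
the partial sums leave the prescribed slope. Penalizing such departures by bounded Lipschitz
functions and integrating out the blocks from the last to the first, one finds that the expected
total penalty of finitely many blocks can be kept below a fixed bound. By compactness one law of the
set does so for all blocks at once, hence almost surely follows the prescribed means from some block
on.

Let the prescribed means be `f_k + q_k (f'_k - f_k)`, where `f_k` and `f'_k` are Lipschitz functions
of the past that converge to the two endpoints and `(q_k)` clusters at every point of `[0, 1]`. Then
`S_n / n` clusters exactly at the interval between the endpoints. Elements of `𝕃_c` have such
approximations almost surely under all laws of the set, by Dini's theorem. Borel functions of
`X₁, …, X_d` have them only almost surely under one law; a further penalty, increasing to `∞` on the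
exceptional null set but of bounded expectation under that law, keeps the constructed law off that
set. -/

/-- Bounded real functions. -/
def IsBdd {α : Type*} (f : α → ℝ) : Prop := ∃ M : ℝ, ∀ x, |f x| ≤ M

namespace IsBdd

variable {α : Type*} {f g : α → ℝ}

lemma of_mem_Icc {a b : ℝ} (h : ∀ x, f x ∈ Set.Icc a b) : IsBdd f :=
  ⟨max |a| |b|, fun x => abs_le_max_abs_abs (h x).1 (h x).2⟩

lemma const (c : ℝ) : IsBdd (fun _ : α => c) := ⟨|c|, fun _ => le_rfl⟩

lemma add (hf : IsBdd f) (hg : IsBdd g) : IsBdd (fun x => f x + g x) := by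
  obtain ⟨M, hM⟩ := hf
  obtain ⟨N, hN⟩ := hg
  exact ⟨M + N, fun x => (abs_add_le _ _).trans (add_le_add (hM x) (hN x))⟩

lemma neg (hf : IsBdd f) : IsBdd (fun x => -f x) :=
  hf.imp fun _ h x => (abs_neg (f x)).trans_le (h x)

lemma sub (hf : IsBdd f) (hg : IsBdd g) : IsBdd (fun x => f x - g x) := by
  simpa only [sub_eq_add_neg] using hf.add hg.neg

lemma comp {β : Type*} (hf : IsBdd f) (u : β → α) : IsBdd (fun x => f (u x)) :=
  hf.imp fun _ h x => h (u x)

lemma integrable [MeasurableSpace α] (hf : IsBdd f) (hm : Measurable f) (ν : Measure α)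
    [IsFiniteMeasure ν] : Integrable f ν := by
  obtain ⟨M, hM⟩ := hf
  exact .of_bound hm.aestronglyMeasurable M (ae_of_all _ hM)

end IsBdd

/-- The point of `[lo, up]` closest to `z` (for `lo ≤ up`). Clamping to `[-c, c]` is the truncation
in the definition of `SublinearExpectation.upperMean`. -/
def clamp (lo up z : ℝ) : ℝ := max lo (min z up)

section clamp

variable {lo up z : ℝ}

lemma clamp_mem_Icc (h : lo ≤ up) (z : ℝ) : clamp lo up z ∈ Set.Icc lo up :=
  ⟨le_max_left _ _, max_le h (min_le_right _ _)⟩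

lemma clamp_of_mem (h : z ∈ Set.Icc lo up) : clamp lo up z = z := by
  rw [clamp, min_eq_left h.2, max_eq_right h.1]

lemma lipschitzWith_clamp (lo up : ℝ) : LipschitzWith 1 (clamp lo up) :=
  (LipschitzWith.id.min_const up).const_max lo

lemma isBdd_clamp (h : lo ≤ up) : IsBdd (clamp lo up) := .of_mem_Icc (clamp_mem_Icc h)

lemma isBddLip_clamp (h : lo ≤ up) : IsBddLip (clamp lo up) :=
  ⟨⟨1, lipschitzWith_clamp lo up⟩, isBdd_clamp h⟩

lemma abs_sub_clamp {c : ℝ} (hc : 0 ≤ c) (z : ℝ) : |z - clamp (-c) c z| = max 0 (|z| - c) := by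
  grind [clamp]

end clamp

/-- The first `n` terms of a sequence. -/
def head (n : ℕ) (x : ℕ → ℝ) : Fin n → ℝ := fun i => x i

lemma continuous_head (n : ℕ) : Continuous (head n) :=
  continuous_pi fun i => continuous_apply (i : ℕ)

lemma head_surjective (n : ℕ) : Function.Surjective (head n) := fun z =>
  ⟨fun i => if h : i < n then z ⟨i, h⟩ else 0, by ext i; simp [head]⟩

lemma head_update (n : ℕ) (x : ℕ → ℝ) (t : ℝ) :
    head (n + 1) (Function.update x n t) = Fin.snoc (head n x) t := by
  ext i
  refine Fin.lastCases ?_ (fun i => ?_) i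
  · simp [head]
  · simp [head, i.2.ne]

lemma lipschitzWith_snoc (n : ℕ) :
    LipschitzWith 1 fun p : (Fin n → ℝ) × ℝ => (Fin.snoc p.1 p.2 : Fin (n + 1) → ℝ) := by
  refine .of_dist_le_mul fun p q => ?_
  rw [NNReal.coe_one, one_mul, dist_pi_le_iff dist_nonneg]
  refine Fin.lastCases ?_ fun i => ?_
  · simp [Prod.dist_eq]
  · simpa [Prod.dist_eq] using .inl (dist_le_pi_dist p.1 q.1 i)

lemma isBddLip_snoc {n : ℕ} {h : (Fin (n + 1) → ℝ) → ℝ} (hh : IsBddLip h) :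
    IsBddLip fun p : (Fin n → ℝ) × ℝ => h (Fin.snoc p.1 p.2) := by
  obtain ⟨⟨K, hK⟩, hb⟩ := hh
  exact ⟨⟨_, hK.comp (lipschitzWith_snoc n)⟩, IsBdd.comp hb _⟩

/-- Functions on `ℝ^ℕ` that are Lipschitz functions of the first `n` coordinates. -/
def IsCylLip (n : ℕ) (f : (ℕ → ℝ) → ℝ) : Prop :=
  ∃ h : (Fin n → ℝ) → ℝ, (∃ K, LipschitzWith K h) ∧ f = h ∘ head n

namespace IsCylLip

variable {n m : ℕ} {f g : (ℕ → ℝ) → ℝ}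

lemma coord {i : ℕ} (h : i < n) : IsCylLip n (fun x => x i) :=
  ⟨fun z => z ⟨i, h⟩, ⟨1, .eval _⟩, rfl⟩

lemma const (c : ℝ) : IsCylLip n (fun _ => c) := ⟨fun _ => c, ⟨0, .const c⟩, rfl⟩

lemma add (hf : IsCylLip n f) (hg : IsCylLip n g) : IsCylLip n (fun x => f x + g x) := by
  obtain ⟨h, ⟨K, hK⟩, rfl⟩ := hf
  obtain ⟨k, ⟨L, hL⟩, rfl⟩ := hg
  exact ⟨fun z => h z + k z, ⟨_, hK.add hL⟩, rfl⟩

lemma comp_lipschitzWith (hf : IsCylLip n f) {u : ℝ → ℝ} {L : NNReal} (hu : LipschitzWith L u) :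
    IsCylLip n (fun x => u (f x)) := by
  obtain ⟨h, ⟨K, hK⟩, rfl⟩ := hf
  exact ⟨u ∘ h, ⟨_, hu.comp hK⟩, rfl⟩

lemma const_mul (hf : IsCylLip n f) (c : ℝ) : IsCylLip n (fun x => c * f x) :=
  hf.comp_lipschitzWith (lipschitzWith_smul c)

lemma neg (hf : IsCylLip n f) : IsCylLip n (fun x => -f x) :=
  hf.comp_lipschitzWith LipschitzWith.id.neg

lemma sub (hf : IsCylLip n f) (hg : IsCylLip n g) : IsCylLip n (fun x => f x - g x) := by
  simpa only [sub_eq_add_neg] using hf.add hg.neg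

lemma sum {ι : Type*} (s : Finset ι) {f : ι → (ℕ → ℝ) → ℝ} (h : ∀ i ∈ s, IsCylLip n (f i)) :
    IsCylLip n (fun x => ∑ i ∈ s, f i x) := by
  induction s using Finset.cons_induction with
  | empty => simpa using const 0
  | cons i s hi ih =>
    simp only [Finset.sum_cons]
    rw [Finset.forall_mem_cons] at h
    exact h.1.add (ih h.2)

lemma mono (hf : IsCylLip n f) (hnm : n ≤ m) : IsCylLip m f := by
  obtain ⟨h, ⟨K, hK⟩, rfl⟩ := hf
  exact ⟨fun z => h fun i => z (i.castLE hnm), ⟨K * 1, hK.comp <| .of_dist_le_mul fun z w => by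
    simpa using (dist_pi_le_iff dist_nonneg).2 fun i => dist_le_pi_dist z w _⟩, rfl⟩

lemma continuous (hf : IsCylLip n f) : Continuous f := by
  obtain ⟨h, ⟨K, hK⟩, rfl⟩ := hf
  exact hK.continuous.comp (continuous_head n)

lemma measurable (hf : IsCylLip n f) : Measurable f := hf.continuous.measurable

lemma congr (hf : IsCylLip n f) {x y : ℕ → ℝ} (hxy : ∀ i < n, x i = y i) : f x = f y := by
  obtain ⟨h, -, rfl⟩ := hf
  exact congrArg h (funext fun i => hxy i i.2)

end IsCylLip

/-- Functions on `ℝ^ℕ` that are bounded Lipschitz functions of the first `n` coordinates. -/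
structure IsBddCylLip (n : ℕ) (f : (ℕ → ℝ) → ℝ) : Prop where
  isCylLip : IsCylLip n f
  isBdd : IsBdd f

namespace IsBddCylLip

variable {n m : ℕ} {f g : (ℕ → ℝ) → ℝ}

lemma const (c : ℝ) : IsBddCylLip n (fun _ => c) := ⟨.const c, .const c⟩

lemma add (hf : IsBddCylLip n f) (hg : IsBddCylLip n g) : IsBddCylLip n (fun x => f x + g x) :=
  ⟨hf.1.add hg.1, hf.2.add hg.2⟩

lemma neg (hf : IsBddCylLip n f) : IsBddCylLip n (fun x => -f x) := ⟨hf.1.neg, hf.2.neg⟩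

lemma sub (hf : IsBddCylLip n f) (hg : IsBddCylLip n g) : IsBddCylLip n (fun x => f x - g x) :=
  ⟨hf.1.sub hg.1, hf.2.sub hg.2⟩

lemma sum {ι : Type*} (s : Finset ι) {f : ι → (ℕ → ℝ) → ℝ} (h : ∀ i ∈ s, IsBddCylLip n (f i)) :
    IsBddCylLip n (fun x => ∑ i ∈ s, f i x) := by
  induction s using Finset.cons_induction with
  | empty => simpa using .const 0
  | cons i s hi ih =>
    simp only [Finset.sum_cons]
    rw [Finset.forall_mem_cons] at h
    exact h.1.add (ih h.2)

lemma mono (hf : IsBddCylLip n f) (hnm : n ≤ m) : IsBddCylLip m f := ⟨hf.1.mono hnm, hf.2⟩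

lemma measurable (hf : IsBddCylLip n f) : Measurable f := hf.1.measurable

lemma integrable (hf : IsBddCylLip n f) (ν : Measure (ℕ → ℝ)) [IsFiniteMeasure ν] :
    Integrable f ν :=
  hf.2.integrable hf.measurable ν

lemma exists_isBddLip (hf : IsBddCylLip n f) :
    ∃ h : (Fin n → ℝ) → ℝ, IsBddLip h ∧ f = h ∘ head n := by
  obtain ⟨⟨h, hK, rfl⟩, M, hM⟩ := hf
  exact ⟨h, ⟨hK, M, (head_surjective n).forall.2 hM⟩, rfl⟩

lemma isBddLip_update (hf : IsBddCylLip (n + 1) f) (x : ℕ → ℝ) :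
    IsBddLip fun t => f (Function.update x n t) := by
  obtain ⟨h, hh, rfl⟩ := hf.exists_isBddLip
  obtain ⟨⟨K, hK⟩, hb⟩ := isBddLip_snoc hh
  simp only [Function.comp_apply, head_update]
  exact ⟨⟨_, hK.comp (.prodMk_left (head n x))⟩, IsBdd.comp hb fun t => (head n x, t)⟩

end IsBddCylLip

namespace SublinearExpectation

variable {Ω : Type*} [MeasurableSpace Ω] (S : SublinearExpectation Ω)

section randomVariables

variable {S} {n : ℕ} {f : (ℕ → ℝ) → ℝ} {X : ℕ → Ω → ℝ} {Z A B : Ω → ℝ}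

lemma cylLip_mem_H (hf : IsCylLip n f) (hX : ∀ i, X i ∈ S.H) :
    (fun ω => f fun i => X i ω) ∈ S.H := by
  obtain ⟨h, ⟨K, hK⟩, rfl⟩ := hf
  refine S.comp_mem n h ⟨K + 1, by positivity, 0, fun x y => ?_⟩ (fun i => X i) fun i => hX i
  calc |h x - h y| ≤ K * ‖x - y‖ := by simpa [Real.dist_eq, dist_eq_norm] using hK.dist_le_mul x y
    _ ≤ (K + 1) * (1 + ‖x‖ ^ 0 + ‖y‖ ^ 0) * ‖x - y‖ := by
      gcongr
      simp only [pow_zero]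
      linarith [K.2]

lemma bddCylLip_mem_Hb (hf : IsBddCylLip n f) (hX : ∀ i, X i ∈ S.H) :
    (fun ω => f fun i => X i ω) ∈ S.Hb :=
  ⟨cylLip_mem_H hf.1 hX, hf.2.comp _⟩

lemma bddLip_mem_Hb {φ : ℝ → ℝ} (hφ : IsBddLip φ) (hZ : Z ∈ S.H) : (fun ω => φ (Z ω)) ∈ S.Hb :=
  hφ.1.elim fun _ hK => bddCylLip_mem_Hb (n := 1) (f := fun x => φ (x 0)) (X := fun _ => Z)
    ⟨(IsCylLip.coord zero_lt_one).comp_lipschitzWith hK, IsBdd.comp hφ.2 _⟩ fun _ => hZ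

lemma const_mem_Hb (c : ℝ) : (fun _ => c) ∈ S.Hb :=
  bddCylLip_mem_Hb (n := 0) (.const c) fun _ => S.H.zero_mem

lemma add_mem_Hb (hA : A ∈ S.Hb) (hB : B ∈ S.Hb) : (fun ω => A ω + B ω) ∈ S.Hb :=
  ⟨S.H.add_mem hA.1 hB.1, IsBdd.add hA.2 hB.2⟩

end randomVariables

/-- The real-valued expectation of a bounded random variable. -/
noncomputable def ev (A : Ω → ℝ) : ℝ := (S.E A).toReal

section ev

variable {S} {A B : Ω → ℝ}

lemma ev_const (c : ℝ) : S.ev (fun _ => c) = c := by simp [ev, S.const]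

lemma coe_ev (hA : A ∈ S.Hb) : (S.ev A : EReal) = S.E A := by
  obtain ⟨hA, M, hM⟩ := hA
  have le_M : S.E A ≤ (M : EReal) := by
    rw [← S.const M]
    exact S.mono _ (const_mem_Hb M).1 _ hA fun ω => (le_abs_self _).trans (hM ω)
  have neg_M_le : ((-M : ℝ) : EReal) ≤ S.E A := by
    rw [← S.const (-M)]
    exact S.mono _ hA _ (const_mem_Hb _).1 fun ω => neg_le_of_abs_le (hM ω)
  exact EReal.coe_toReal (ne_top_of_le_ne_top (EReal.coe_ne_top _) le_M)
    (ne_bot_of_le_ne_bot (EReal.coe_ne_bot _) neg_M_le)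

lemma ev_mono (hA : A ∈ S.Hb) (hB : B ∈ S.Hb) (h : ∀ ω, A ω ≤ B ω) : S.ev A ≤ S.ev B := by
  rw [← EReal.coe_le_coe_iff, coe_ev hA, coe_ev hB]
  exact S.mono _ hB.1 _ hA.1 h

lemma ev_add_le (hA : A ∈ S.Hb) (hB : B ∈ S.Hb) :
    S.ev (fun ω => A ω + B ω) ≤ S.ev A + S.ev B := by
  rw [← EReal.coe_le_coe_iff, EReal.coe_add, coe_ev hA, coe_ev hB, coe_ev (add_mem_Hb hA hB)]
  refine S.subadd _ hA.1 _ hB.1 ?_ ?_ <;> simp [← coe_ev hA]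

lemma ev_add_const_le (hA : A ∈ S.Hb) (c : ℝ) : S.ev (fun ω => A ω + c) ≤ S.ev A + c := by
  simpa only [ev_const] using ev_add_le hA (const_mem_Hb c)

lemma abs_ev_sub_ev_le (hA : A ∈ S.Hb) (hB : B ∈ S.Hb) {c : ℝ} (h : ∀ ω, |A ω - B ω| ≤ c) :
    |S.ev A - S.ev B| ≤ c := by
  have ev_le : ∀ {A B : Ω → ℝ}, A ∈ S.Hb → B ∈ S.Hb → (∀ ω, |A ω - B ω| ≤ c) →
      S.ev A ≤ S.ev B + c := fun {A B} hA hB h =>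
    (ev_mono hA (add_mem_Hb hB (const_mem_Hb c)) fun ω => by
      linarith [le_of_abs_le (h ω)]).trans (ev_add_const_le hB c)
  exact abs_sub_le_iff.2 ⟨by linarith [ev_le hA hB h],
    by linarith [ev_le hB hA fun ω => (abs_sub_comm _ _).trans_le (h ω)]⟩

end ev

/-- The expectation of `f` over its coordinate `n`, distributed as `X n`, the other coordinates
being fixed. -/
noncomputable def marginal (X : ℕ → Ω → ℝ) (n : ℕ) (f : (ℕ → ℝ) → ℝ) (x : ℕ → ℝ) : ℝ :=
  S.ev fun ω => f (Function.update x n (X n ω))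

/-- The probability measures on `ℝ` dominated by the distribution of `Z` under the sub-linear
expectation. -/
def dominatedLaws (Z : Ω → ℝ) : Set (ProbabilityMeasure ℝ) :=
  {p | ∀ φ : ℝ → ℝ, IsBddLip φ → ∫ t, φ t ∂(p : Measure ℝ) ≤ S.ev fun ω => φ (Z ω)}

/-- The expectation of a bounded function of a sequence of random variables. -/
noncomputable abbrev evSeq (X : ℕ → Ω → ℝ) (f : (ℕ → ℝ) → ℝ) : ℝ := S.ev fun ω => f fun i => X i ω

section marginal

variable {S} {X : ℕ → Ω → ℝ} {n : ℕ} {f : (ℕ → ℝ) → ℝ}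

lemma update_mem_Hb (hX : ∀ i, X i ∈ S.H) (hf : IsBddCylLip (n + 1) f) (x : ℕ → ℝ) :
    (fun ω => f (Function.update x n (X n ω))) ∈ S.Hb :=
  bddLip_mem_Hb (hf.isBddLip_update x) (hX n)

lemma isBddCylLip_marginal (hX : ∀ i, X i ∈ S.H) (hf : IsBddCylLip (n + 1) f) :
    IsBddCylLip n (S.marginal X n f) := by
  have update_mem := update_mem_Hb hX hf
  obtain ⟨M, hM⟩ := hf.2
  obtain ⟨h, hh, rfl⟩ := hf.exists_isBddLip
  obtain ⟨⟨K, hK⟩, -⟩ := isBddLip_snoc hh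
  simp only [Function.comp_apply, head_update] at update_mem
  refine ⟨⟨fun z => S.ev fun ω => h (Fin.snoc z (X n ω)), ⟨K, .of_dist_le_mul ?_⟩, ?_⟩,
    M, fun x => ?_⟩
  · refine (head_surjective n).forall₂.2 fun x y => abs_ev_sub_ev_le (update_mem x) (update_mem y)
      fun ω => ?_
    simpa [Real.dist_eq, Prod.dist_eq] using hK.dist_le_mul (head n x, X n ω) (head n y, X n ω)
  · ext x
    simp [marginal, head_update]
  · simpa [ev_const, marginal, head_update] using
      abs_ev_sub_ev_le (update_mem x) (const_mem_Hb 0) (c := M) fun ω => by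
        simpa [head_update] using hM (Function.update x n (X n ω))

lemma ev_marginal (hX : S.IsIID X) (hn : 1 ≤ n) (hf : IsBddCylLip (n + 1) f) :
    S.evSeq X (S.marginal X n f) = S.evSeq X f := by
  obtain ⟨h, hh, rfl⟩ := hf.exists_isBddLip
  obtain ⟨k, rfl⟩ := Nat.exists_eq_add_of_le' hn
  have snoc_head : ∀ x t, h (Fin.snoc (head (k + 1) x) t) =
      (h ∘ head (k + 2)) (Function.update x (k + 1) t) := fun x t => by
    rw [Function.comp_apply, head_update]
  have indep := congrArg EReal.toReal (hX.indep k _ (isBddLip_snoc hh))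
  simp only [show ∀ ω, (fun j : Fin (k + 1) => X j ω) = head (k + 1) fun i => X i ω from
    fun _ => rfl, snoc_head] at indep
  simp only [Function.update_eq_self] at indep
  exact indep.symm

lemma integral_le_marginal (hX : S.IsIID X) (hf : IsBddCylLip (n + 1) f)
    {p : ProbabilityMeasure ℝ} (hp : p ∈ S.dominatedLaws (X 0)) (x : ℕ → ℝ) :
    ∫ t, f (Function.update x n t) ∂(p : Measure ℝ) ≤ S.marginal X n f x := by
  have h := hp _ (hf.isBddLip_update x)
  rwa [ev, ← hX.identDistrib n _ (hf.isBddLip_update x)] at h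

end marginal

end SublinearExpectation

/-- The sequence with the first `m` terms of `x`, followed by `y`. -/
def splice (m : ℕ) (x y : ℕ → ℝ) (i : ℕ) : ℝ := if i < m then x i else y (i - m)

lemma splice_of_lt {m i : ℕ} (h : i < m) (x y : ℕ → ℝ) : splice m x y i = x i := if_pos h

lemma splice_add (m i : ℕ) (x y : ℕ → ℝ) : splice m x y (m + i) = y i := by simp [splice]

lemma measurable_splice (m : ℕ) (x : ℕ → ℝ) : Measurable (splice m x) :=
  measurable_pi_lambda _ fun i => by unfold splice; split_ifs <;> fun_prop

lemma IsCylLip.apply_splice {m : ℕ} {f : (ℕ → ℝ) → ℝ} (hf : IsCylLip m f) (x y : ℕ → ℝ) :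
    f (splice m x y) = f x :=
  hf.congr fun _ hi => splice_of_lt hi x y

lemma update_splice (m j : ℕ) (x y : ℕ → ℝ) (t : ℝ) :
    Function.update (splice m x y) (m + j) t = splice m x (Function.update y j t) := by
  ext i
  simp only [Function.update_apply, splice]
  grind

lemma map_update_infinitePi {ι : Type*} [DecidableEq ι] {α : ι → Type*}
    [∀ i, MeasurableSpace (α i)] (μ : ∀ i, Measure (α i)) [∀ i, IsProbabilityMeasure (μ i)]
    (j : ι) :
    ((Measure.infinitePi μ).prod (μ j)).map (fun z => Function.update z.1 j z.2) =
      Measure.infinitePi μ := by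
  refine Measure.eq_infinitePi _ fun s t ht => ?_
  have preimage_pi : (fun z : (∀ i, α i) × α j => Function.update z.1 j z.2) ⁻¹' (s : Set ι).pi t =
      ((s.erase j : Finset ι) : Set ι).pi t ×ˢ {y | j ∈ s → y ∈ t j} := by
    ext ⟨x, y⟩
    simp only [Set.mem_preimage, Set.mem_pi, Set.mem_prod, Finset.mem_coe, Finset.mem_erase]
    refine ⟨fun h => ⟨fun i hi => by simpa [hi.1] using h i hi.2, fun hj => by simpa using h j hj⟩,
      fun h i hi => ?_⟩
    obtain rfl | hij := eq_or_ne i j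
    · simpa using h.2 hi
    · simpa [hij] using h.1 i ⟨hij, hi⟩
  rw [Measure.map_apply measurable_update' (.pi s.countable_toSet fun i _ => ht i), preimage_pi,
    Measure.prod_prod, Measure.infinitePi_pi _ fun i _ => ht i]
  by_cases hj : j ∈ s
  · simpa [hj] using Finset.prod_erase_mul s (fun i => μ i (t i)) hj
  · simp [hj]

/-- The law of a sequence of independent random variables with law `p`. -/
noncomputable abbrev iidLaw (p : ProbabilityMeasure ℝ) : Measure (ℕ → ℝ) :=
  Measure.infinitePi fun _ => (p : Measure ℝ)

lemma IsBddCylLip.integrable_splice {n : ℕ} {f : (ℕ → ℝ) → ℝ} (hf : IsBddCylLip n f) (m : ℕ)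
    (x : ℕ → ℝ) (p : ProbabilityMeasure ℝ) :
    Integrable (fun y => f (splice m x y)) (iidLaw p) :=
  (hf.2.comp _).integrable (hf.measurable.comp (measurable_splice m x)) _

namespace SublinearExpectation

variable {Ω : Type*} [MeasurableSpace Ω] (S : SublinearExpectation Ω)

section independence

variable {S} {X : ℕ → Ω → ℝ} {m : ℕ}

lemma integral_splice_le_integral_splice_marginal (hX : S.IsIID X) {j : ℕ} {f : (ℕ → ℝ) → ℝ}
    (hf : IsBddCylLip (m + j + 1) f) {p : ProbabilityMeasure ℝ} (hp : p ∈ S.dominatedLaws (X 0))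
    (x : ℕ → ℝ) :
    ∫ y, f (splice m x y) ∂iidLaw p ≤ ∫ y, S.marginal X (m + j) f (splice m x y) ∂iidLaw p := by
  have measurable_update : Measurable fun z : (ℕ → ℝ) × ℝ => Function.update z.1 j z.2 :=
    measurable_update'
  have measurable_f : Measurable fun y => f (splice m x y) :=
    hf.measurable.comp (measurable_splice m x)
  have integrable_update : Integrable (fun z : (ℕ → ℝ) × ℝ => f (splice m x (Function.update z.1 j
      z.2))) ((iidLaw p).prod p) :=
    (hf.2.comp _).integrable (measurable_f.comp measurable_update) _
  calc ∫ y, f (splice m x y) ∂iidLaw p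
      = ∫ y, ∫ t, f (splice m x (Function.update y j t)) ∂(p : Measure ℝ) ∂iidLaw p := by
        conv_lhs => rw [iidLaw, ← map_update_infinitePi _ j]
        rw [integral_map measurable_update.aemeasurable measurable_f.aestronglyMeasurable,
          integral_prod _ integrable_update]
    _ ≤ _ := integral_mono integrable_update.integral_prod_left
        ((isBddCylLip_marginal hX.mem hf).integrable_splice m x p) fun y => by
          simpa only [update_splice] using integral_le_marginal hX hf hp (splice m x y)

lemma evSeq_le_evSeq_of_le_integral_splice (hX : S.IsIID X) (hm : 1 ≤ m) (j : ℕ)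
    {F f : (ℕ → ℝ) → ℝ} (hF : IsBddCylLip m F) (hf : IsBddCylLip (m + j) f)
    (h : ∀ x, ∃ p ∈ S.dominatedLaws (X 0), F x ≤ ∫ y, f (splice m x y) ∂iidLaw p) :
    S.evSeq X F ≤ S.evSeq X f := by
  induction j generalizing f with
  | zero =>
    have hf : IsBddCylLip m f := hf
    refine ev_mono (bddCylLip_mem_Hb hF hX.mem) (bddCylLip_mem_Hb hf hX.mem) fun ω => ?_
    obtain ⟨p, -, hp⟩ := h fun i => X i ω
    simpa [hf.1.apply_splice] using hp
  | succ j ih =>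
    refine (ih (isBddCylLip_marginal hX.mem hf) fun x => ?_).trans_eq (ev_marginal hX (by omega) hf)
    obtain ⟨p, hp, hle⟩ := h x
    exact ⟨p, hp, hle.trans (integral_splice_le_integral_splice_marginal hX hf hp x)⟩

lemma evSeq_sub_le_evSeq_sub (hX : S.IsIID X) (hm : 1 ≤ m) {n : ℕ} (hmn : m ≤ n)
    {f g : (ℕ → ℝ) → ℝ} (hf : IsBddCylLip m f) (hg : IsBddCylLip n g) {δ : ℝ}
    (h : ∀ x, ∃ p ∈ S.dominatedLaws (X 0), ∫ y, g (splice m x y) ∂iidLaw p ≤ δ) :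
    S.evSeq X f - δ ≤ S.evSeq X fun x => f x - g x := by
  have hfδ : IsBddCylLip m fun x => f x - δ := hf.sub (.const δ)
  obtain ⟨j, rfl⟩ := Nat.exists_eq_add_of_le hmn
  have le_ev_sub : S.evSeq X f - δ ≤ S.evSeq X fun x => f x - δ := by
    simpa only [sub_add_cancel, sub_le_iff_le_add]
      using ev_add_const_le (bddCylLip_mem_Hb hfδ hX.mem) δ
  refine le_ev_sub.trans (evSeq_le_evSeq_of_le_integral_splice hX hm j hfδ
    ((hf.mono hmn).sub hg) fun x => ?_)
  obtain ⟨p, hp, hle⟩ := h x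
  refine ⟨p, hp, ?_⟩
  simp only [hf.1.apply_splice]
  rw [integral_sub (integrable_const _) (hg.integrable_splice m x p), integral_const, probReal_univ,
    one_smul]
  exact sub_le_sub_left hle _

end independence

/-- The law on `ℝ^ℕ` of the sequence `X` under `P`. -/
noncomputable def law (P : S.Prob) (X : ℕ → Ω → ℝ) : Measure (ℕ → ℝ) :=
  @Measure.map Ω (ℕ → ℝ) S.sigma _ (fun ω i => X i ω) P

section law

variable {S} {Ps : Set S.Prob} {X : ℕ → Ω → ℝ} {P : S.Prob} {ν : ProbabilityMeasure (ℕ → ℝ)}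

lemma measurable_sigma {Z : Ω → ℝ} (hZ : Z ∈ S.H) : Measurable[S.sigma] Z :=
  measurable_iff_comap_le.2 (le_iSup₂_of_le (f := fun X (_ : X ∈ S.H) =>
    MeasurableSpace.comap X (borel ℝ)) Z hZ le_rfl)

lemma measurable_sigma_pi (hX : ∀ i, X i ∈ S.H) : Measurable[S.sigma] fun ω i => X i ω :=
  @measurable_pi_lambda Ω ℕ (fun _ => ℝ) S.sigma _ _ fun i => measurable_sigma (hX i)

lemma law_apply (hX : ∀ i, X i ∈ S.H) {A : Set (ℕ → ℝ)} (hA : MeasurableSet A) :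
    S.law P X A = (P : @Measure Ω S.sigma) {ω | (fun i => X i ω) ∈ A} :=
  Measure.map_apply (measurable_sigma_pi hX) hA

lemma integral_law (hX : ∀ i, X i ∈ S.H) {f : (ℕ → ℝ) → ℝ} (hf : Measurable f) :
    ∫ x, f x ∂S.law P X = ∫ ω, f (fun i => X i ω) ∂(P : @Measure Ω S.sigma) :=
  integral_map (measurable_sigma_pi hX).aemeasurable hf.aestronglyMeasurable

lemma lintegral_law (hX : ∀ i, X i ∈ S.H) {f : (ℕ → ℝ) → ℝ≥0∞} (hf : Measurable f) :
    ∫⁻ x, f x ∂S.law P X = ∫⁻ ω, f (fun i => X i ω) ∂(P : @Measure Ω S.sigma) :=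
  @lintegral_map Ω _ S.sigma _ _ f _ hf (measurable_sigma_pi hX)

lemma mem_laws_iff (hX : ∀ i, X i ∈ S.H) :
    ν ∈ S.laws Ps X ↔ ∃ P ∈ Ps, (ν : Measure (ℕ → ℝ)) = S.law P X := by
  refine exists_congr fun P => and_congr_right fun _ => ?_
  simp +contextual [Measure.ext_iff, law_apply hX]

lemma exists_mem_laws_eq_law (hX : ∀ i, X i ∈ S.H) (hP : P ∈ Ps) :
    ∃ ν ∈ S.laws Ps X, (ν : Measure (ℕ → ℝ)) = S.law P X :=
  ⟨⟨S.law P X, Measure.isProbabilityMeasure_map (measurable_sigma_pi hX).aemeasurable⟩,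
    (mem_laws_iff hX).2 ⟨P, hP, rfl⟩, rfl⟩

lemma laws_mono {Ps' : Set S.Prob} (h : Ps ⊆ Ps') (X : ℕ → Ω → ℝ) :
    S.laws Ps X ⊆ S.laws Ps' X :=
  fun _ ⟨P, hP, hν⟩ => ⟨P, h hP, hν⟩

lemma laws_comp (hX : ∀ i, X i ∈ S.H) {T : (ℕ → ℝ) → ℕ → ℝ} (hT : Measurable T) :
    S.laws Ps (fun i ω => T (fun j => X j ω) i) =
      (fun ν => ν.map hT.aemeasurable) '' S.laws Ps X := by
  ext η
  constructor
  · rintro ⟨P, hP, hη⟩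
    obtain ⟨ν, hν, hνP⟩ := exists_mem_laws_eq_law hX hP
    refine ⟨ν, hν, ProbabilityMeasure.toMeasure_injective <| Measure.ext fun A hA => ?_⟩
    dsimp only
    rw [ProbabilityMeasure.toMeasure_map, Measure.map_apply hT hA, hνP, law_apply hX (hT hA)]
    exact (hη A hA).symm
  · rintro ⟨ν, ⟨P, hP, hν⟩, rfl⟩
    refine ⟨P, hP, fun A hA => ?_⟩
    rw [ProbabilityMeasure.toMeasure_map, Measure.map_apply hT hA]
    exact hν _ (hT hA)

lemma exists_measure_eq_one_of_ae (hν : ν ∈ S.laws Ps X)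
    {p : (ℕ → ℝ) → Prop} (hp : ∀ᵐ x ∂(ν : Measure (ℕ → ℝ)), p x) :
    ∃ P ∈ Ps, (P : @Measure Ω S.sigma) {ω | p fun i => X i ω} = 1 := by
  obtain ⟨P, hP, hνP⟩ := hν
  obtain ⟨A, hA_ae, hA, hAp⟩ := hp.exists_measurable_mem
  refine ⟨P, hP, le_antisymm (@prob_le_one Ω S.sigma _ _ _) ?_⟩
  calc 1 = (ν : Measure (ℕ → ℝ)) A := ((prob_compl_eq_zero_iff hA).1 (mem_ae_iff.1 hA_ae)).symm
    _ = (P : @Measure Ω S.sigma) {ω | (fun i => X i ω) ∈ A} := hνP A hA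
    _ ≤ (P : @Measure Ω S.sigma) {ω | p fun i => X i ω} := measure_mono fun ω hω => hAp _ hω

end law

section maxFamily

variable {S} {Ps : Set S.Prob} {X : ℕ → Ω → ℝ} {ν : ProbabilityMeasure (ℕ → ℝ)} {n : ℕ}
  {f : (ℕ → ℝ) → ℝ}

lemma subset_maxFamily (hCC : S.ConditionCC Ps) : Ps ⊆ S.maxFamily := fun P hP A hA =>
  (le_iSup₂ (f := fun (P : S.Prob) (_ : P ∈ Ps) =>
    ((∫ ω, A ω ∂(P : @Measure Ω S.sigma) : ℝ) : EReal)) P hP).trans_eq (hCC.eq_sup A hA).symm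

lemma integral_le_evSeq (hX : ∀ i, X i ∈ S.H) (hν : ν ∈ S.laws S.maxFamily X)
    (hf : IsBddCylLip n f) : ∫ x, f x ∂(ν : Measure (ℕ → ℝ)) ≤ S.evSeq X f := by
  obtain ⟨P, hP, hνP⟩ := (mem_laws_iff hX).1 hν
  have mem_Hb := bddCylLip_mem_Hb hf hX
  rw [hνP, integral_law hX hf.measurable, ← EReal.coe_le_coe_iff, coe_ev mem_Hb]
  exact hP _ mem_Hb

lemma exists_lt_integral (hCC : S.ConditionCC Ps) (hX : ∀ i, X i ∈ S.H) (hf : IsBddCylLip n f)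
    {c : ℝ} (hc : c < S.evSeq X f) :
    ∃ ν ∈ S.laws Ps X, c < ∫ x, f x ∂(ν : Measure (ℕ → ℝ)) := by
  have mem_Hb := bddCylLip_mem_Hb hf hX
  rw [← EReal.coe_lt_coe_iff, coe_ev mem_Hb, hCC.eq_sup _ mem_Hb] at hc
  obtain ⟨P, hP, hcP⟩ := by simpa only [lt_iSup_iff] using hc
  obtain ⟨ν, hν, hνP⟩ := exists_mem_laws_eq_law hX hP
  refine ⟨ν, hν, ?_⟩
  rw [hνP, integral_law hX hf.measurable]
  exact EReal.coe_lt_coe_iff.1 hcP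

lemma laws_nonempty (hCC : S.ConditionCC Ps) (hX : ∀ i, X i ∈ S.H) : (S.laws Ps X).Nonempty := by
  obtain ⟨ν, hν, -⟩ := exists_lt_integral hCC hX (.const (n := 0) 0) (c := -1) <| by
    simp [evSeq, ev_const]
  exact ⟨ν, hν⟩

lemma exists_forall_integral_le (hCC : S.ConditionCC Ps) (hX : ∀ i, X i ∈ S.H)
    {f : ℕ → (ℕ → ℝ) → ℝ} {n : ℕ → ℕ} (hf : ∀ k, IsBddCylLip (n k) (f k)) {c : ℕ → ℝ}
    (h : ∀ K, ∃ ν ∈ S.laws Ps X, ∀ k ≤ K, ∫ x, f k x ∂(ν : Measure (ℕ → ℝ)) ≤ c k) :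
    ∃ ν ∈ S.laws Ps X, ∀ k, ∫ x, f k x ∂(ν : Measure (ℕ → ℝ)) ≤ c k := by
  choose M hM using fun k => (hf k).2
  have hM0 : ∀ k, 0 ≤ M k := fun k => (abs_nonneg _).trans (hM k 0)
  let coord (k : ℕ) : (ℕ → ℝ) →ᵇ ℝ := .ofNormedAddCommGroup (fun y => clamp (-M k) (M k) (y k))
    ((lipschitzWith_clamp _ _).continuous.comp (continuous_apply k)) (M k) fun y =>
      abs_le.2 (clamp_mem_Icc (neg_le_self (hM0 k)) _)
  have measurable_f : Measurable fun x k => f k x := measurable_pi_lambda _ fun k =>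
    (hf k).measurable
  let law_f (ν : ProbabilityMeasure (ℕ → ℝ)) : ProbabilityMeasure (ℕ → ℝ) :=
    ν.map measurable_f.aemeasurable
  have integral_coord : ∀ ν k, ∫ y, coord k y ∂(law_f ν : Measure (ℕ → ℝ)) =
      ∫ x, f k x ∂(ν : Measure (ℕ → ℝ)) := fun ν k => by
    rw [ProbabilityMeasure.toMeasure_map, integral_map measurable_f.aemeasurable
      (coord k).continuous.aestronglyMeasurable]
    exact integral_congr_ae (ae_of_all _ fun x => clamp_of_mem (abs_le.1 (hM k x)))
  have compact := hCC.compact (fun k ω => f k fun i => X i ω) fun k => bddCylLip_mem_Hb (hf k) hX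
  rw [laws_comp hX measurable_f (Ps := Ps)] at compact
  obtain ⟨_, ⟨ν, hν, rfl⟩, hνc⟩ := compact.inter_iInter_nonempty
    (fun k => {η : ProbabilityMeasure (ℕ → ℝ) | ∫ y, coord k y ∂(η : Measure (ℕ → ℝ)) ≤ c k})
    (fun k => isClosed_le (ProbabilityMeasure.continuous_integral_boundedContinuousFunction _)
      continuous_const) fun u => by
      obtain ⟨ν, hν, hνu⟩ := h (u.sup id)
      exact ⟨law_f ν, ⟨ν, hν, rfl⟩, Set.mem_iInter₂.2 fun k hk =>
        (integral_coord ν k).trans_le (hνu k (Finset.le_sup (f := id) hk))⟩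
  exact ⟨ν, hν, fun k => (integral_coord ν k).symm.trans_le (Set.mem_iInter.1 hνc k)⟩

end maxFamily

section capacity

variable {S} {P : S.Prob}

lemma upperCapacity_le {A : Set Ω} {c : ℝ} (h : ∀ ω, A.indicator (fun _ => (1 : ℝ)) ω ≤ c) :
    S.upperCapacity A ≤ ENNReal.ofReal c := by
  refine (iInf₂_le_of_le (fun _ => c) (const_mem_Hb c).1 (iInf_le _ h)).trans_eq ?_
  rw [S.const, EReal.toENNReal_of_ne_top (EReal.coe_ne_top _), EReal.toReal_coe]

lemma upperCapacity_empty : S.upperCapacity ∅ = 0 := by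
  simpa using S.upperCapacity_le (A := ∅) (c := 0) (by simp)

lemma upperCapacity_univ : S.upperCapacity Set.univ = 1 := by
  refine le_antisymm (by simpa using S.upperCapacity_le (A := Set.univ) (c := 1) (by simp)) ?_
  refine le_iInf fun ξ => le_iInf₂ fun hξ one_le => ?_
  rw [← EReal.coe_ennreal_le_coe_ennreal_iff, EReal.coe_ennreal_one, ← EReal.coe_one, ← S.const 1]
  rw [EReal.coe_toENNReal_eq_max]
  exact (S.mono _ hξ _ (const_mem_Hb 1).1 fun ω => by simpa using one_le ω).trans (le_max_right _ _)

lemma measure_le_upperCapacity (hP : P ∈ S.maxFamily) (A : Set Ω) :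
    (P : @Measure Ω S.sigma) A ≤ S.upperCapacity A := by
  refine le_iInf fun ξ => le_iInf₂ fun hξ hAξ => ?_
  have ξ_nonneg : ∀ ω, 0 ≤ ξ ω := fun ω => (Set.indicator_nonneg (by simp) ω).trans (hAξ ω)
  have clamp_mem : (fun ω => clamp 0 1 (ξ ω)) ∈ S.Hb :=
    bddLip_mem_Hb (isBddLip_clamp zero_le_one) hξ
  have clamp_measurable := measurable_sigma clamp_mem.1
  have clamp_nonneg : ∀ ω, 0 ≤ clamp 0 1 (ξ ω) := fun ω => (clamp_mem_Icc zero_le_one _).1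
  calc (P : @Measure Ω S.sigma) A
      ≤ (P : @Measure Ω S.sigma) {ω | 1 ≤ ENNReal.ofReal (clamp 0 1 (ξ ω))} := by
        refine measure_mono fun ω hω => ?_
        have one_le : 1 ≤ ξ ω := by simpa [hω] using hAξ ω
        simp [clamp, one_le]
    _ ≤ ∫⁻ ω, ENNReal.ofReal (clamp 0 1 (ξ ω)) ∂(P : @Measure Ω S.sigma) := by
        simpa using @mul_meas_ge_le_lintegral Ω S.sigma (P : @Measure Ω S.sigma) _
          clamp_measurable.ennreal_ofReal 1
    _ = ENNReal.ofReal (∫ ω, clamp 0 1 (ξ ω) ∂(P : @Measure Ω S.sigma)) :=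
        (ofReal_integral_eq_lintegral_ofReal (@IsBdd.integrable Ω _ S.sigma clamp_mem.2
          clamp_measurable _ _) (ae_of_all _ clamp_nonneg)).symm
    _ = ((∫ ω, clamp 0 1 (ξ ω) ∂(P : @Measure Ω S.sigma) : ℝ) : EReal).toENNReal := by
        rw [EReal.toENNReal_of_ne_top (EReal.coe_ne_top _), EReal.toReal_coe]
    _ ≤ (S.E ξ).toENNReal := EReal.toENNReal_le_toENNReal <| (hP _ clamp_mem).trans <|
        S.mono _ hξ _ clamp_mem.1 fun ω => max_le (ξ_nonneg ω) (min_le_left _ _)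

lemma outerCapacity_le_one (A : Set Ω) : S.outerCapacity A ≤ 1 := by
  let B (n : ℕ) : Set Ω := if n = 0 then Set.univ else ∅
  have measurable_B : ∀ n, MeasurableSet (B n) := fun n => by unfold B; split_ifs <;> simp
  have subset_B : A ⊆ ⋃ n, B n := fun ω _ => Set.mem_iUnion.2 ⟨0, by simp [B]⟩
  refine (iInf_le_of_le B (iInf₂_le measurable_B subset_B)).trans ?_
  rw [tsum_eq_single 0 fun n hn => by simp [B, hn, upperCapacity_empty]]
  exact upperCapacity_univ.le

lemma measure_le_outerCapacity (hP : P ∈ S.maxFamily) (A : Set Ω) :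
    (P : @Measure Ω S.sigma) A ≤ S.outerCapacity A :=
  le_iInf fun B => le_iInf₂ fun _ hAB => (measure_mono hAB).trans <|
    (measure_iUnion_le B).trans <| ENNReal.tsum_le_tsum fun n => measure_le_upperCapacity hP (B n)

lemma outerCapacity_eq_one (hP : P ∈ S.maxFamily) {A : Set Ω}
    (hA : (P : @Measure Ω S.sigma) A = 1) : S.outerCapacity A = 1 :=
  (outerCapacity_le_one A).antisymm (hA ▸ measure_le_outerCapacity hP A)

end capacity

section tail

variable {S} {Z : Ω → ℝ}

/-- The tail of the Choquet integral of `|Z|`. -/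
noncomputable def tail (S : SublinearExpectation Ω) (Z : Ω → ℝ) (c : ℝ) : ℝ≥0∞ :=
  ∫⁻ t in Set.Ioi c, S.upperCapacity {ω | t ≤ |Z ω|}

lemma tail_neg (Z : Ω → ℝ) : S.tail (fun ω => -Z ω) = S.tail Z := by simp [funext_iff, tail]

lemma tail_antitone (Z : Ω → ℝ) : Antitone (S.tail Z) := fun _ _ h =>
  lintegral_mono_set (Set.Ioi_subset_Ioi h)

lemma tail_zero_ne_top (h : S.choquet (fun ω => |Z ω|) < ⊤) :
    S.tail Z 0 ≠ ⊤ := by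
  have one_sub_eq_zero : ∀ t ∈ Set.Iio (0 : ℝ), 1 - S.upperCapacity {ω | t ≤ |Z ω|} = 0 := by
    intro t ht
    have eq_univ : {ω | t ≤ |Z ω|} = Set.univ :=
      Set.eq_univ_of_forall fun ω => (le_of_lt (Set.mem_Iio.1 ht)).trans (abs_nonneg _)
    rw [eq_univ, upperCapacity_univ, tsub_self]
  intro htop
  rw [choquet, setLIntegral_congr_fun measurableSet_Iio one_sub_eq_zero, lintegral_zero, ← tail,
    htop] at h
  simp at h

lemma tendsto_tail_atTop (h : S.tail Z 0 ≠ ⊤) :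
    Tendsto (fun c => (S.tail Z c).toReal) atTop (𝓝 0) := by
  have tendsto_measure := tendsto_measure_iInter_atTop (ι := ℝ)
    (μ := volume.withDensity fun t => S.upperCapacity {ω | t ≤ |Z ω|}) (s := Set.Ioi)
    (fun c => measurableSet_Ioi.nullMeasurableSet) (fun a b h => Set.Ioi_subset_Ioi h)
    ⟨0, by rwa [withDensity_apply _ measurableSet_Ioi]⟩
  have iInter_eq_empty : (⋂ c : ℝ, Set.Ioi c) = ∅ := by
    simpa [Set.eq_empty_iff_forall_notMem] using fun x => ⟨x, le_rfl⟩
  rw [iInter_eq_empty, measure_empty] at tendsto_measure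
  refine ((ENNReal.tendsto_toReal ENNReal.zero_ne_top).comp tendsto_measure).congr fun c => ?_
  rw [Function.comp_apply, Function.comp_apply, withDensity_apply _ measurableSet_Ioi, tail]

end tail

end SublinearExpectation

lemma measurableSet_le_abs (t : ℝ) : MeasurableSet {z : ℝ | t ≤ |z|} :=
  measurableSet_le measurable_const measurable_norm

lemma lintegral_excess_le (μ : Measure ℝ) {V : ℝ → ℝ≥0∞} (hV : ∀ t, μ {z | t ≤ |z|} ≤ V t)
    (c : ℝ) :
    ∫⁻ z, ENNReal.ofReal (max 0 (|z| - c)) ∂μ ≤ ∫⁻ t in Set.Ioi c, V t := by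
  have measurable_excess : Measurable fun z : ℝ => max 0 (|z| - c) := by fun_prop
  have translate := (measurePreserving_add_right volume c).setLIntegral_comp_preimage_emb
    (MeasurableEquiv.addRight c).measurableEmbedding V (Set.Ioi c)
  rw [Set.preimage_add_const_Ioi, sub_self] at translate
  rw [lintegral_eq_lintegral_meas_le μ (ae_of_all _ fun z => le_max_left 0 (|z| - c))
    measurable_excess.aemeasurable, ← translate]
  refine setLIntegral_mono' measurableSet_Ioi fun t ht => (measure_mono fun z hz => ?_).trans (hV _)
  rcases le_max_iff.1 (show t ≤ max 0 (|z| - c) from hz) with h | h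
  · exact absurd h ht.not_ge
  · exact le_sub_iff_add_le.1 h

namespace SublinearExpectation

variable {Ω : Type*} [MeasurableSpace Ω] (S : SublinearExpectation Ω)

/-- The laws on `ℝ` which are dominated by the law of `Z`, and whose two-sided tails are dominated
by the capacities of the tails of `Z`. -/
def controlledLaws (Z : Ω → ℝ) : Set (ProbabilityMeasure ℝ) :=
  {p ∈ S.dominatedLaws Z |
    ∀ t, (p : Measure ℝ) {z | t ≤ |z|} ≤ S.upperCapacity {ω | t ≤ |Z ω|}}

/-- The expectations of the controlled laws. -/
def means (Z : Ω → ℝ) : Set ℝ :=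
  (fun p : ProbabilityMeasure ℝ => ∫ t, t ∂(p : Measure ℝ)) '' S.controlledLaws Z

variable {S} {Ps : Set S.Prob} {Z : Ω → ℝ} {p : ProbabilityMeasure ℝ}

section controlledLaws

lemma map_eval_mem_controlledLaws {X : ℕ → Ω → ℝ} (hX : ∀ i, X i ∈ S.H)
    {ν : ProbabilityMeasure (ℕ → ℝ)} (hν : ν ∈ S.laws S.maxFamily X) (i : ℕ) :
    ν.map (measurable_pi_apply i).aemeasurable ∈ S.controlledLaws (X i) := by
  refine ⟨fun φ hφ => ?_, fun t => ?_⟩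
  · rw [ProbabilityMeasure.toMeasure_map, integral_map (measurable_pi_apply i).aemeasurable
      hφ.1.choose_spec.continuous.aestronglyMeasurable]
    exact integral_le_evSeq hX hν
      ⟨(IsCylLip.coord i.lt_succ_self).comp_lipschitzWith hφ.1.choose_spec, IsBdd.comp hφ.2 _⟩
  · obtain ⟨P, hP, hνP⟩ := hν
    rw [ProbabilityMeasure.toMeasure_map, Measure.map_apply (measurable_pi_apply i)
        (measurableSet_le_abs t), hνP _ (measurable_pi_apply i (measurableSet_le_abs t))]
    exact measure_le_upperCapacity hP _

lemma exists_mem_controlledLaws_lt_integral (hCC : S.ConditionCC Ps) (hZ : Z ∈ S.H) {φ : ℝ → ℝ}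
    (hφ : IsBddLip φ) {c : ℝ} (hc : c < S.ev fun ω => φ (Z ω)) :
    ∃ p ∈ S.controlledLaws Z, c < ∫ t, φ t ∂(p : Measure ℝ) := by
  obtain ⟨K, hK⟩ := hφ.1
  obtain ⟨ν, hν, hcν⟩ := exists_lt_integral hCC (X := fun _ => Z) (fun _ => hZ) (n := 1)
    ⟨(IsCylLip.coord one_pos).comp_lipschitzWith hK, IsBdd.comp hφ.2 _⟩ hc
  have hν_max := laws_mono (subset_maxFamily hCC) _ hν
  refine ⟨_, map_eval_mem_controlledLaws (fun _ => hZ) hν_max 0, ?_⟩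
  rwa [ProbabilityMeasure.toMeasure_map, integral_map (measurable_pi_apply 0).aemeasurable
    hK.continuous.aestronglyMeasurable]

lemma integrable_of_mem_controlledLaws (h : S.tail Z 0 ≠ ⊤) (hp : p ∈ S.controlledLaws Z) :
    Integrable (fun t => t) (p : Measure ℝ) := by
  refine ⟨aestronglyMeasurable_id, hasFiniteIntegral_iff_norm _ |>.2 ?_⟩
  simpa using (lintegral_excess_le _ hp.2 0).trans_lt h.lt_top

lemma abs_integral_sub_integral_clamp_le (h : S.tail Z 0 ≠ ⊤) (hp : p ∈ S.controlledLaws Z) {c : ℝ}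
    (hc : 0 ≤ c) :
    |∫ t, t ∂(p : Measure ℝ) - ∫ t, clamp (-c) c t ∂(p : Measure ℝ)| ≤ (S.tail Z c).toReal := by
  rw [← integral_sub (integrable_of_mem_controlledLaws h hp)
    ((isBdd_clamp (neg_le_self hc)).integrable (lipschitzWith_clamp _ _).continuous.measurable _),
    ← Real.norm_eq_abs]
  refine (norm_integral_le_lintegral_norm _).trans
    (ENNReal.toReal_mono (ne_top_of_le_ne_top h (tail_antitone Z hc)) ?_)
  simpa only [Real.norm_eq_abs, abs_sub_clamp hc, tail] using lintegral_excess_le _ hp.2 c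

end controlledLaws

section means

lemma means_nonempty (hCC : S.ConditionCC Ps) (hZ : Z ∈ S.H) : (S.means Z).Nonempty := by
  obtain ⟨p, hp, -⟩ := exists_mem_controlledLaws_lt_integral hCC hZ (φ := fun _ => 0) (c := -1)
    ⟨⟨0, .const 0⟩, IsBdd.const 0⟩ (by simp [ev_const])
  exact ⟨_, p, hp, rfl⟩

lemma bddAbove_means (h : S.tail Z 0 ≠ ⊤) : BddAbove (S.means Z) := by
  refine ⟨(S.tail Z 0).toReal, ?_⟩
  rintro _ ⟨p, hp, rfl⟩
  have clamp_zero : ∀ t, clamp (-0) 0 t = 0 := by simp [clamp]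
  simpa only [clamp_zero, integral_zero, sub_zero] using
    le_of_abs_le (abs_integral_sub_integral_clamp_le h hp le_rfl)

lemma abs_ev_clamp_sub_sSup_means_le (hCC : S.ConditionCC Ps) (hZ : Z ∈ S.H) (h : S.tail Z 0 ≠ ⊤)
    {c : ℝ} (hc : 0 ≤ c) :
    |S.ev (fun ω => clamp (-c) c (Z ω)) - sSup (S.means Z)| ≤ (S.tail Z c).toReal := by
  have isBddLip_clamp_c := isBddLip_clamp (neg_le_self hc)
  rw [abs_le', neg_sub]
  constructor <;> rw [sub_le_iff_le_add']
  · refine le_of_forall_lt fun a ha => ?_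
    obtain ⟨p, hp, hap⟩ := exists_mem_controlledLaws_lt_integral hCC hZ isBddLip_clamp_c ha
    have le_sSup : _ ≤ sSup (S.means Z) := le_csSup (bddAbove_means h) ⟨p, hp, rfl⟩
    linarith [neg_le_of_abs_le (abs_integral_sub_integral_clamp_le h hp hc)]
  · refine csSup_le (means_nonempty hCC hZ) ?_
    rintro _ ⟨p, hp, rfl⟩
    linarith [le_of_abs_le (abs_integral_sub_integral_clamp_le h hp hc), hp.1 _ isBddLip_clamp_c]

lemma upperMean_eq_sSup_means (hCC : S.ConditionCC Ps) (hZ : Z ∈ S.H) (h : S.tail Z 0 ≠ ⊤) :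
    S.upperMean Z = (sSup (S.means Z) : ℝ) := by
  have tendsto_ev : Tendsto (fun c => S.ev fun ω => clamp (-c) c (Z ω)) atTop
      (𝓝 (sSup (S.means Z))) :=
    tendsto_iff_dist_tendsto_zero.2 <| squeeze_zero' (.of_forall fun _ => dist_nonneg)
      ((eventually_ge_atTop 0).mono fun c hc => abs_ev_clamp_sub_sSup_means_le hCC hZ h hc)
      (tendsto_tail_atTop h)
  refine (((continuous_coe_real_ereal.tendsto _).comp tendsto_ev).congr' ?_).limUnder_eq
  filter_upwards [eventually_ge_atTop 0] with c hc
  exact coe_ev (bddLip_mem_Hb (isBddLip_clamp (neg_le_self hc)) hZ)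

lemma means_neg_subset (Z : Ω → ℝ) : S.means (fun ω => -Z ω) ⊆ -S.means Z := by
  rintro _ ⟨p, hp, rfl⟩
  refine ⟨p.map measurable_neg.aemeasurable, ⟨fun φ hφ => ?_, fun t => ?_⟩, ?_⟩
  · obtain ⟨⟨K, hK⟩, hφ_bdd⟩ := hφ
    rw [ProbabilityMeasure.toMeasure_map, integral_map measurable_neg.aemeasurable
      hK.continuous.aestronglyMeasurable]
    simpa using hp.1 (fun t => φ (-t))
      ⟨⟨K * 1, hK.comp (.of_dist_le_mul fun s t => by simp)⟩, IsBdd.comp hφ_bdd _⟩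
  · rw [ProbabilityMeasure.toMeasure_map, Measure.map_apply measurable_neg
      (measurableSet_le_abs t)]
    simpa using hp.2 t
  · dsimp only
    rw [ProbabilityMeasure.toMeasure_map, integral_map (f := fun t => t) measurable_neg.aemeasurable
      aestronglyMeasurable_id, integral_neg]

lemma means_neg (Z : Ω → ℝ) : S.means (fun ω => -Z ω) = -S.means Z :=
  (means_neg_subset Z).antisymm fun a ha => by
    have mem := means_neg_subset (S := S) (fun ω => -Z ω) (a := -a)
    simp only [neg_neg, Set.mem_neg] at mem
    exact mem ha

lemma lowerMean_eq_sInf_means (hCC : S.ConditionCC Ps) (hZ : Z ∈ S.H) (h : S.tail Z 0 ≠ ⊤) :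
    S.lowerMean Z = (sInf (S.means Z) : ℝ) := by
  have upper_neg := upperMean_eq_sSup_means hCC (Z := fun ω => -Z ω) (neg_mem hZ)
    (by rwa [tail_neg])
  rw [lowerMean, upper_neg, means_neg, Real.sInf_def, EReal.coe_neg]

lemma convex_means (h : S.tail Z 0 ≠ ⊤) : Convex ℝ (S.means Z) := by
  rintro _ ⟨p, hp, rfl⟩ _ ⟨q, hq, rfl⟩ a b ha hb hab
  let μ : Measure ℝ := a.toNNReal • p + b.toNNReal • q
  have toNNReal_add : a.toNNReal + b.toNNReal = 1 := by
    rw [← Real.toNNReal_add ha hb, hab, Real.toNNReal_one]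
  have isProbabilityMeasure_μ : IsProbabilityMeasure μ := ⟨by
    simp only [μ, Measure.add_apply, Measure.smul_apply, measure_univ, ENNReal.smul_def,
      smul_eq_mul, mul_one]
    exact_mod_cast toNNReal_add⟩
  have integral_mix {f : ℝ → ℝ} (hfp : Integrable f (p : Measure ℝ))
      (hfq : Integrable f (q : Measure ℝ)) :
      ∫ t, f t ∂μ = a * ∫ t, f t ∂(p : Measure ℝ) + b * ∫ t, f t ∂(q : Measure ℝ) := by
    rw [integral_add_measure (hfp.smul_measure_nnreal) (hfq.smul_measure_nnreal),
      integral_smul_nnreal_measure, integral_smul_nnreal_measure]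
    simp [NNReal.smul_def, ha, hb]
  refine ⟨⟨μ, isProbabilityMeasure_μ⟩, ⟨fun φ hφ => ?_, fun t => ?_⟩, integral_mix
    (integrable_of_mem_controlledLaws h hp) (integrable_of_mem_controlledLaws h hq)⟩
  · have measurable_φ := hφ.1.choose_spec.continuous.measurable
    refine (integral_mix (IsBdd.integrable hφ.2 measurable_φ _)
      (IsBdd.integrable hφ.2 measurable_φ _)).trans_le ?_
    calc _ ≤ a * S.ev (fun ω => φ (Z ω)) + b * S.ev (fun ω => φ (Z ω)) := by
          gcongr
          exacts [hp.1 φ hφ, hq.1 φ hφ]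
      _ = _ := by rw [← add_mul, hab, one_mul]
  · calc μ {z | t ≤ |z|}
        ≤ a.toNNReal • S.upperCapacity {ω | t ≤ |Z ω|}
          + b.toNNReal • S.upperCapacity {ω | t ≤ |Z ω|} :=
          add_le_add (smul_le_smul_of_nonneg_left (hp.2 t) zero_le)
            (smul_le_smul_of_nonneg_left (hq.2 t) zero_le)
      _ = _ := by rw [← add_smul, toNNReal_add, one_smul]

lemma Icc_subset_closure_means (hCC : S.ConditionCC Ps) (hZ : Z ∈ S.H) (h : S.tail Z 0 ≠ ⊤) :
    Set.Icc (sInf (S.means Z)) (sSup (S.means Z)) ⊆ closure (S.means Z) := by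
  have nonempty := means_nonempty hCC hZ
  have bddBelow : BddBelow (S.means Z) := by
    rw [← bddAbove_neg, ← means_neg]
    exact bddAbove_means (by rwa [tail_neg])
  exact (convex_means h).closure.ordConnected.out (csInf_mem_closure nonempty bddBelow)
    (csSup_mem_closure nonempty (bddAbove_means h))

end means

end SublinearExpectation

section lln

lemma exists_forall_abs_sum_sub_le {y : ℕ → ℝ} {a ε : ℝ} (hε : 0 < ε)
    (h : Tendsto (fun j : ℕ => (∑ i ∈ Finset.range j, y i) / j) atTop (𝓝 a)) :
    ∃ M : ℕ, ∀ j : ℕ, |∑ i ∈ Finset.range j, y i - j * a| ≤ ε * (M + j) := by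
  have eventually_le : ∀ᶠ j : ℕ in atTop, |∑ i ∈ Finset.range j, y i - j * a| - ε * j ≤ 0 := by
    filter_upwards [h.eventually (Metric.closedBall_mem_nhds a hε), eventually_gt_atTop 0]
      with j hj hj0
    have cast_pos : (0 : ℝ) < j := Nat.cast_pos.2 hj0
    rwa [Real.dist_eq, div_sub' cast_pos.ne', abs_div, abs_of_pos cast_pos,
      div_le_iff₀ cast_pos, ← sub_nonpos] at hj
  obtain ⟨C, hC⟩ := (isBoundedUnder_of_eventually_le eventually_le).bddAbove_range
  obtain ⟨M, hM⟩ := exists_nat_ge (C / ε)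
  refine ⟨M, fun j => ?_⟩
  have le_C : |∑ i ∈ Finset.range j, y i - j * a| - ε * j ≤ C := hC ⟨j, rfl⟩
  rw [div_le_iff₀' hε] at hM
  linarith

/-- The event that some partial sum of `y` is far from the line of slope `a`: it exceeds an error
of `ε` per term, where the first `m` terms of a longer sequence also contribute to the error. -/
def deviation (a ε : ℝ) (m : ℕ) : Set (ℕ → ℝ) :=
  {y | ∃ j : ℕ, ε * (m + j) < |∑ i ∈ Finset.range j, y i - j * a|}

lemma measurableSet_deviation (a ε : ℝ) (m : ℕ) : MeasurableSet (deviation a ε m) := by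
  rw [deviation, Set.ofPred_exists]
  exact .iUnion fun j => measurableSet_lt (by fun_prop) (by fun_prop)

lemma antitone_deviation (a : ℝ) {ε : ℝ} (hε : 0 ≤ ε) : Antitone (deviation a ε) :=
  fun m n hmn _ ⟨j, hj⟩ => ⟨j, hj.trans_le' (by gcongr)⟩

lemma deviation_subset_deviation_half {a b ε : ℝ} (hε : 0 ≤ ε) (hab : |b - a| ≤ ε / 2) (m : ℕ) :
    deviation a ε m ⊆ deviation b (ε / 2) m := by
  rintro y ⟨j, hj⟩
  refine ⟨j, ?_⟩
  have triangle : |∑ i ∈ Finset.range j, y i - j * a| ≤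
      |∑ i ∈ Finset.range j, y i - j * b| + j * |b - a| := by
    rw [← abs_of_nonneg (Nat.cast_nonneg (α := ℝ) j), ← abs_mul,
      abs_of_nonneg (Nat.cast_nonneg (α := ℝ) j)]
    exact (abs_add_le _ _).trans_eq' (by ring_nf)
  have shift_le : (j : ℝ) * |b - a| ≤ j * (ε / 2) := by gcongr
  have head_nonneg : 0 ≤ ε * m := by positivity
  linarith

lemma iInter_deviation_ae_eq_zero (p : ProbabilityMeasure ℝ)
    (hp : Integrable (fun t => t) (p : Measure ℝ)) {ε : ℝ} (hε : 0 < ε) :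
    iidLaw p (⋂ m, deviation (∫ t, t ∂(p : Measure ℝ)) ε m) = 0 := by
  have measurePreserving_eval (i : ℕ) : MeasurePreserving (fun y => y i) (iidLaw p) p :=
    measurePreserving_eval_infinitePi (fun _ => (p : Measure ℝ)) i
  have strong_law := ProbabilityTheory.strong_law_ae_real (μ := iidLaw p) (fun i y => y i)
    ((measurePreserving_eval 0).integrable_comp_of_integrable hp)
    (fun i j hij => (ProbabilityTheory.iIndepFun_infinitePi (P := fun _ : ℕ => (p : Measure ℝ))
      (X := fun _ t => t) fun _ => measurable_id).indepFun hij)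
    (fun i => ⟨(measurable_pi_apply i).aemeasurable, (measurable_pi_apply 0).aemeasurable,
      (measurePreserving_eval i).map_eq.trans (measurePreserving_eval 0).map_eq.symm⟩)
  have mean_eq : ∫ y, y 0 ∂iidLaw p = ∫ t, t ∂(p : Measure ℝ) := by
    rw [← (measurePreserving_eval 0).map_eq]
    exact (integral_map (φ := fun y : ℕ → ℝ => y 0) (f := fun t => t)
      (measurable_pi_apply 0).aemeasurable aestronglyMeasurable_id).symm
  refine measure_mono_null (fun y hy => ?_) (ae_iff.1 strong_law)
  intro lim
  obtain ⟨M, hM⟩ := exists_forall_abs_sum_sub_le hε lim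
  obtain ⟨j, hj⟩ := Set.mem_iInter.1 hy M
  exact hj.not_ge (mean_eq ▸ hM j)

lemma eventually_deviation_le (p : ProbabilityMeasure ℝ)
    (hp : Integrable (fun t => t) (p : Measure ℝ)) {ε : ℝ} (hε : 0 < ε) {δ : ℝ≥0∞} (hδ : 0 < δ) :
    ∀ᶠ m in atTop, iidLaw p (deviation (∫ t, t ∂(p : Measure ℝ)) ε m) ≤ δ := by
  have tendsto_measure := tendsto_measure_iInter_atTop (μ := iidLaw p)
    (fun m => (measurableSet_deviation (∫ t, t ∂(p : Measure ℝ)) ε m).nullMeasurableSet)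
    (antitone_deviation _ hε.le) ⟨0, measure_ne_top _ _⟩
  rw [iInter_deviation_ae_eq_zero p hp hε] at tendsto_measure
  exact tendsto_measure.eventually_le_const hδ

lemma eventually_forall_exists_deviation_le {D : Set (ProbabilityMeasure ℝ)}
    (hD : ∀ p ∈ D, Integrable (fun t => t) (p : Measure ℝ)) {A : Set ℝ} (hA : IsCompact A)
    (hAD : A ⊆ closure ((fun p : ProbabilityMeasure ℝ => ∫ t, t ∂(p : Measure ℝ)) '' D))
    {ε : ℝ} (hε : 0 < ε) {δ : ℝ≥0∞} (hδ : 0 < δ) :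
    ∀ᶠ m in atTop, ∀ a ∈ A, ∃ p ∈ D, iidLaw p (deviation a ε m) ≤ δ := by
  have exists_near : ∀ a ∈ A, ∃ p ∈ D, dist a (∫ t, t ∂(p : Measure ℝ)) < ε / 4 := fun a ha => by
    simpa using Metric.mem_closure_iff.1 (hAD ha) (ε / 4) (by positivity)
  choose! p hp hap using exists_near
  obtain ⟨t, ht, hcover⟩ := hA.elim_nhds_subcover (fun a => Metric.ball a (ε / 4))
    fun a _ => Metric.ball_mem_nhds a (by positivity)
  have eventually_t := (eventually_all_finset t).2 fun b hb =>
    eventually_deviation_le (p b) (hD _ (hp b (ht b hb))) (half_pos hε) hδ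
  filter_upwards [eventually_t] with m hm a ha
  obtain ⟨b, hbt, hab⟩ := Set.mem_iUnion₂.1 (hcover ha)
  refine ⟨p b, hp b (ht b hbt), (measure_mono (deviation_subset_deviation_half hε.le ?_ m)).trans
    (hm b hbt)⟩
  have triangle := dist_triangle_right (∫ t, t ∂(p b : Measure ℝ)) a b
  rw [← Real.dist_eq]
  linarith [hap b (ht b hbt), dist_comm b (∫ t, t ∂(p b : Measure ℝ)), Metric.mem_ball.1 hab]

end lln

section penalty

/-- A penalty in `[0, 1]` which vanishes if on the block `[m, n)` the sequence follows the mean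
`a` up to `ε` times the length of the initial segment, and equals `1` if it is off by twice that. -/
noncomputable def blockPenalty (m n : ℕ) (ε : ℝ) (a : (ℕ → ℝ) → ℝ) (x : ℕ → ℝ) : ℝ :=
  min 1 (∑ k ∈ Finset.Icc m n,
    max 0 ((ε * k)⁻¹ * |∑ i ∈ Finset.Ico m k, x i - ((k - m : ℕ) : ℝ) * a x| - 1))

variable {m n : ℕ} {ε : ℝ} {a : (ℕ → ℝ) → ℝ}

lemma blockPenalty_nonneg (x : ℕ → ℝ) : 0 ≤ blockPenalty m n ε a x :=
  le_min zero_le_one (Finset.sum_nonneg fun _ _ => le_max_left _ _)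

lemma isBddCylLip_blockPenalty (hmn : m ≤ n) (ha : IsCylLip m a) :
    IsBddCylLip n (blockPenalty m n ε a) := by
  refine ⟨?_, .of_mem_Icc fun x => ⟨blockPenalty_nonneg x, min_le_left _ _⟩⟩
  have isCylLip_error : ∀ k ∈ Finset.Icc m n, IsCylLip n fun x =>
      |∑ i ∈ Finset.Ico m k, x i - ((k - m : ℕ) : ℝ) * a x| := fun k hk =>
    ((IsCylLip.sum _ fun i hi => .coord ((Finset.mem_Ico.1 hi).2.trans_le
      (Finset.mem_Icc.1 hk).2)).sub ((ha.mono hmn).const_mul _)).comp_lipschitzWith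
        (u := fun t => |t|) lipschitzWith_one_norm
  exact (IsCylLip.sum _ fun k hk => (((isCylLip_error k hk).const_mul _).sub
    (.const 1)).comp_lipschitzWith (LipschitzWith.id.const_max 0)).comp_lipschitzWith
      (LipschitzWith.id.const_min 1)

lemma abs_le_of_blockPenalty_lt_one (hm : 1 ≤ m) (hε : 0 < ε) {x : ℕ → ℝ}
    (h : blockPenalty m n ε a x < 1) {k : ℕ} (hk : k ∈ Finset.Icc m n) :
    |∑ i ∈ Finset.Ico m k, x i - ((k - m : ℕ) : ℝ) * a x| ≤ 2 * ε * k := by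
  have k_pos : (0 : ℝ) < k := Nat.cast_pos.2 (hm.trans (Finset.mem_Icc.1 hk).1)
  have excess_lt_one : (ε * k)⁻¹ * |∑ i ∈ Finset.Ico m k, x i - ((k - m : ℕ) : ℝ) * a x| - 1 < 1 :=
    (le_max_right (0 : ℝ) _).trans_lt <| (Finset.single_le_sum (f := fun k : ℕ =>
      max 0 ((ε * k)⁻¹ * |∑ i ∈ Finset.Ico m k, x i - ((k - m : ℕ) : ℝ) * a x| - 1))
      (fun _ _ => le_max_left _ _) hk).trans_lt
        ((min_lt_iff.1 h).resolve_left (lt_irrefl _))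
  rw [sub_lt_iff_lt_add, inv_mul_lt_iff₀ (by positivity)] at excess_lt_one
  linarith

lemma sum_Ico_splice (m k : ℕ) (x y : ℕ → ℝ) :
    ∑ i ∈ Finset.Ico m k, splice m x y i = ∑ i ∈ Finset.range (k - m), y i := by
  rw [Finset.sum_Ico_eq_sum_range]
  exact Finset.sum_congr rfl fun i _ => splice_add m i x y

lemma blockPenalty_splice_le_indicator (hm : 1 ≤ m) (hε : 0 < ε) (ha : IsCylLip m a)
    (x y : ℕ → ℝ) :
    blockPenalty m n ε a (splice m x y) ≤ (deviation (a x) ε m).indicator (fun _ => 1) y := by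
  by_cases hy : y ∈ deviation (a x) ε m
  · rw [Set.indicator_of_mem hy]
    exact min_le_left _ _
  rw [Set.indicator_of_notMem hy]
  refine (min_le_right _ _).trans (Finset.sum_nonpos fun k hk => max_le le_rfl ?_)
  have hmk : m ≤ k := (Finset.mem_Icc.1 hk).1
  have k_pos : (0 : ℝ) < k := Nat.cast_pos.2 (hm.trans hmk)
  have error_le := not_lt.1 (not_exists.1 hy (k - m))
  rw [ha.apply_splice, sum_Ico_splice, sub_nonpos, inv_mul_le_iff₀ (by positivity), mul_one]
  rwa [← Nat.cast_add, Nat.add_sub_cancel' hmk] at error_le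

lemma integral_blockPenalty_splice_le (hm : 1 ≤ m) (hε : 0 < ε) (hmn : m ≤ n) (ha : IsCylLip m a)
    {p : ProbabilityMeasure ℝ} {δ : ℝ} (hδ : 0 ≤ δ) (x : ℕ → ℝ)
    (h : iidLaw p (deviation (a x) ε m) ≤ ENNReal.ofReal δ) :
    ∫ y, blockPenalty m n ε a (splice m x y) ∂iidLaw p ≤ δ := by
  have measurable_deviation := measurableSet_deviation (a x) ε m
  refine (integral_mono ((isBddCylLip_blockPenalty hmn ha).integrable_splice m x p)
    ((integrable_const 1).indicator measurable_deviation)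
    (blockPenalty_splice_le_indicator hm hε ha x)).trans ?_
  rw [integral_indicator_const _ measurable_deviation, smul_eq_mul, mul_one]
  exact ENNReal.toReal_le_of_le_ofReal hδ h

end penalty

lemma ae_bddAbove_of_integral_le {α : Type*} {mα : MeasurableSpace α} {μ : Measure α}
    {G : ℕ → α → ℝ} (hG : ∀ K, Measurable (G K)) (hGint : ∀ K, Integrable (G K) μ)
    (hG0 : ∀ K x, 0 ≤ G K x) (hGmono : ∀ x, Monotone fun K => G K x) {C : ℝ}
    (h : ∀ K, ∫ x, G K x ∂μ ≤ C) :
    ∀ᵐ x ∂μ, BddAbove (Set.range fun K => G K x) := by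
  have measurable_ofReal K : Measurable fun x => ENNReal.ofReal (G K x) := (hG K).ennreal_ofReal
  have lintegral_ne_top : ∫⁻ x, ⨆ K, ENNReal.ofReal (G K x) ∂μ ≠ ⊤ := by
    rw [lintegral_iSup measurable_ofReal fun i j hij x => ENNReal.ofReal_le_ofReal (hGmono x hij)]
    refine ne_top_of_le_ne_top (ENNReal.ofReal_ne_top (r := C)) (iSup_le fun K => ?_)
    rw [← ofReal_integral_eq_lintegral_ofReal (hGint K) (ae_of_all _ (hG0 K))]
    exact ENNReal.ofReal_le_ofReal (h K)
  filter_upwards [ae_lt_top (.iSup measurable_ofReal) lintegral_ne_top] with x hx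
  refine ⟨(⨆ K, ENNReal.ofReal (G K x)).toReal, ?_⟩
  rintro _ ⟨K, rfl⟩
  exact (ENNReal.ofReal_le_iff_le_toReal hx.ne).1 (le_iSup (fun K => ENNReal.ofReal (G K x)) K)

namespace SublinearExpectation

variable {Ω : Type*} [MeasurableSpace Ω] {S : SublinearExpectation Ω} {Ps : Set S.Prob}
  {X : ℕ → Ω → ℝ}

lemma evSeq_sub_sum_le_evSeq_sub_sum (hX : S.IsIID X) {n : ℕ → ℕ} (hn : Monotone n)
    (hn0 : 1 ≤ n 0) {g : ℕ → (ℕ → ℝ) → ℝ} (hg : ∀ k, IsBddCylLip (n (k + 1)) (g k)) {δ : ℕ → ℝ}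
    (hgδ : ∀ k x, ∃ p ∈ S.dominatedLaws (X 0), ∫ y, g k (splice (n k) x y) ∂iidLaw p ≤ δ k)
    {f : (ℕ → ℝ) → ℝ} (hf : IsBddCylLip (n 0) f) (K : ℕ) :
    S.evSeq X f - ∑ k ∈ Finset.range K, δ k ≤
      S.evSeq X fun x => f x - ∑ k ∈ Finset.range K, g k x := by
  induction K with
  | zero => simp
  | succ K ih =>
    have block_le := evSeq_sub_le_evSeq_sub hX (hn0.trans (hn K.zero_le)) (hn K.le_succ)
      ((hf.mono (hn K.zero_le)).sub (.sum _ fun k hk =>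
        (hg k).mono (hn (Finset.mem_range.1 hk)))) (hg K) (hgδ K)
    simp only [Finset.sum_range_succ, ← sub_sub]
    linarith

/-- Penalties `g k`, each of them small when the block after time `n k` is governed by a suitable
dominated law, are all controlled by one common law; so are the costs `H K`, which only see the
time before the first block. -/
lemma exists_integral_add_sum_le (hCC : S.ConditionCC Ps) (hX : S.IsIID X) {n : ℕ → ℕ}
    (hn : Monotone n) (hn0 : 1 ≤ n 0) {g : ℕ → (ℕ → ℝ) → ℝ}
    (hg : ∀ k, IsBddCylLip (n (k + 1)) (g k)) (hg0 : ∀ k x, 0 ≤ g k x) {δ : ℕ → ℝ}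
    (hδ : Summable δ) (hδ0 : ∀ k, 0 ≤ δ k)
    (hgδ : ∀ k x, ∃ p ∈ S.dominatedLaws (X 0), ∫ y, g k (splice (n k) x y) ∂iidLaw p ≤ δ k)
    {H : ℕ → (ℕ → ℝ) → ℝ} (hH : ∀ K, IsBddCylLip (n 0) (H K)) (hHmono : ∀ x, Monotone (H · x))
    {C : ℝ} (hC : ∀ K, -C ≤ S.evSeq X fun x => -H K x) :
    ∃ ν ∈ S.laws Ps X, ∀ K, ∫ x, (H K x + ∑ k ∈ Finset.range K, g k x) ∂(ν : Measure (ℕ → ℝ)) ≤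
      C + ∑' k, δ k + 1 := by
  have isBddCylLip_sum K : IsBddCylLip (n K) fun x => H K x + ∑ k ∈ Finset.range K, g k x :=
    ((hH K).mono (hn K.zero_le)).add (.sum _ fun k hk => (hg k).mono (hn (Finset.mem_range.1 hk)))
  refine exists_forall_integral_le hCC hX.mem isBddCylLip_sum fun K => ?_
  have le_evSeq := evSeq_sub_sum_le_evSeq_sub_sum hX hn hn0 hg hgδ (hH K).neg K
  simp only [← neg_add'] at le_evSeq
  obtain ⟨ν, hν, hlt⟩ := exists_lt_integral hCC hX.mem (isBddCylLip_sum K).neg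
    (c := -(C + ∑' k, δ k + 1))
    (by linarith [hC K, hδ.sum_le_tsum (Finset.range K) fun k _ => hδ0 k])
  rw [integral_neg, neg_lt_neg_iff] at hlt
  refine ⟨ν, hν, fun k hk => (integral_mono ((isBddCylLip_sum k).integrable _)
    ((isBddCylLip_sum K).integrable _) fun x => ?_).trans hlt.le⟩
  exact add_le_add (hHmono x hk) (Finset.sum_le_sum_of_subset_of_nonneg
    (Finset.range_mono hk) fun i _ _ => hg0 i x)

lemma exists_ae_bddAbove_tendsto_zero (hCC : S.ConditionCC Ps) (hX : S.IsIID X) {n : ℕ → ℕ}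
    (hn : Monotone n) (hn0 : 1 ≤ n 0) {g : ℕ → (ℕ → ℝ) → ℝ}
    (hg : ∀ k, IsBddCylLip (n (k + 1)) (g k)) (hg0 : ∀ k x, 0 ≤ g k x) {δ : ℕ → ℝ}
    (hδ : Summable δ) (hδ0 : ∀ k, 0 ≤ δ k)
    (hgδ : ∀ k x, ∃ p ∈ S.dominatedLaws (X 0), ∫ y, g k (splice (n k) x y) ∂iidLaw p ≤ δ k)
    {H : ℕ → (ℕ → ℝ) → ℝ} (hH : ∀ K, IsBddCylLip (n 0) (H K)) (hH0 : ∀ K x, 0 ≤ H K x)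
    (hHmono : ∀ x, Monotone (H · x)) {C : ℝ} (hC : ∀ K, -C ≤ S.evSeq X fun x => -H K x) :
    ∃ ν ∈ S.laws Ps X, ∀ᵐ x ∂(ν : Measure (ℕ → ℝ)),
      BddAbove (Set.range fun K => H K x) ∧ Tendsto (fun k => g k x) atTop (𝓝 0) := by
  obtain ⟨ν, hν, hle⟩ := exists_integral_add_sum_le hCC hX hn hn0 hg hg0 hδ hδ0 hgδ hH hHmono hC
  have isBddCylLip_sum K : IsBddCylLip (n K) fun x => H K x + ∑ k ∈ Finset.range K, g k x :=
    ((hH K).mono (hn K.zero_le)).add (.sum _ fun k hk => (hg k).mono (hn (Finset.mem_range.1 hk)))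
  have sum_nonneg K x : 0 ≤ ∑ k ∈ Finset.range K, g k x := Finset.sum_nonneg fun k _ => hg0 k x
  refine ⟨ν, hν, ?_⟩
  filter_upwards [ae_bddAbove_of_integral_le (fun K => (isBddCylLip_sum K).measurable)
    (fun K => (isBddCylLip_sum K).integrable _) (fun K x => add_nonneg (hH0 K x) (sum_nonneg K x))
    (fun x => (hHmono x).add (monotone_nat_of_le_succ fun K => by
      simpa only [Finset.sum_range_succ] using le_add_of_nonneg_right (hg0 K x))) hle]
    with x ⟨B, hB⟩
  have le_B K : H K x + ∑ k ∈ Finset.range K, g k x ≤ B := hB ⟨K, rfl⟩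
  refine ⟨⟨B, ?_⟩, (summable_of_sum_range_le (hg0 · x) fun K =>
    (le_add_of_nonneg_left (hH0 K x)).trans (le_B K)).tendsto_atTop_zero⟩
  rintro _ ⟨K, rfl⟩
  exact (le_add_of_nonneg_right (sum_nonneg K x)).trans (le_B K)

end SublinearExpectation

section clusterSet

lemma exists_seq_forall_mapClusterPt : ∃ q : ℕ → ℝ, (∀ k, q k ∈ Set.Icc (0 : ℝ) 1) ∧
    ∀ t ∈ Set.Icc (0 : ℝ) 1, MapClusterPt t atTop q := by
  refine ⟨fun k => TopologicalSpace.denseSeq unitInterval k.unpair.1, fun k => Subtype.prop _,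
    fun t ht => mapClusterPt_iff_frequently.2 fun U hU => frequently_atTop.2 fun N => ?_⟩
  obtain ⟨V, hVU, hV, htV⟩ := mem_nhds_iff.1 hU
  obtain ⟨i, hi⟩ := (TopologicalSpace.denseRange_denseSeq unitInterval).exists_mem_open
    (hV.preimage continuous_subtype_val) ⟨⟨t, ht⟩, htV⟩
  exact ⟨Nat.pair i N, Nat.right_le_pair i N, hVU (by simpa using hi)⟩

lemma tendsto_zero_of_le_half_add {u δ : ℕ → ℝ} (hu : ∀ k, 0 ≤ u k)
    (hδ : Tendsto δ atTop (𝓝 0)) (h : ∀ᶠ k in atTop, u (k + 1) ≤ u k / 2 + δ k) :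
    Tendsto u atTop (𝓝 0) := by
  refine Metric.tendsto_atTop.2 fun ε hε => ?_
  obtain ⟨N, hN⟩ := eventually_atTop.1 (h.and (hδ.eventually_lt_const (u := ε / 4) (by positivity)))
  have le_geometric (j : ℕ) : u (N + j) ≤ ε / 2 + (1 / 2) ^ j * u N := by
    induction j with
    | zero => simpa using (half_pos hε).le
    | succ j ih =>
      obtain ⟨le_half, lt_quarter⟩ := hN (N + j) (by omega)
      rw [← add_assoc, pow_succ]
      linarith
  have tendsto_geometric : Tendsto (fun j : ℕ => (1 / 2 : ℝ) ^ j * u N) atTop (𝓝 0) := by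
    simpa using (tendsto_pow_atTop_nhds_zero_of_lt_one (r := (1 / 2 : ℝ)) (by norm_num)
      (by norm_num)).mul_const (u N)
  obtain ⟨J, hJ⟩ := eventually_atTop.1 (tendsto_geometric.eventually_lt_const (half_pos hε))
  refine ⟨N + J, fun k hk => ?_⟩
  obtain ⟨j, rfl⟩ := Nat.exists_eq_add_of_le hk
  rw [Real.dist_eq, sub_zero, abs_of_nonneg (hu _), add_assoc]
  linarith [le_geometric (J + j), hJ (J + j) (by omega)]

lemma exists_strictMono_seq_ge (T : ℕ → ℕ) : ∃ n : ℕ → ℕ, StrictMono n ∧ (∀ k, T k ≤ n k) ∧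
    ∀ k, (k + 1) * n k ≤ n (k + 1) := by
  let n : ℕ → ℕ := fun k => Nat.rec (T 0) (fun k m => (k + 1) * m + T (k + 1) + 1) k
  have n_succ k : n (k + 1) = (k + 1) * n k + T (k + 1) + 1 := rfl
  refine ⟨n, strictMono_nat_of_lt_succ fun k => ?_, fun k => ?_, fun k => ?_⟩
  · rw [n_succ, add_one_mul]
    omega
  · cases k with
    | zero => exact le_rfl
    | succ k => rw [n_succ]; omega
  · rw [n_succ]
    omega

variable {x : ℕ → ℝ} {n : ℕ → ℕ} {b ε : ℕ → ℝ} {lo up : ℝ}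

lemma abs_runningAverage_sub_le {m k : ℕ} (hm : 1 ≤ m) (hmk : m ≤ k) {b ε : ℝ}
    (h : |∑ i ∈ Finset.Ico m k, x i - ((k - m : ℕ) : ℝ) * b| ≤ ε * k) :
    |runningAverage x k - (m / k * runningAverage x m + (1 - m / k) * b)| ≤ ε := by
  have : (0 : ℝ) < m := Nat.cast_pos.2 hm
  have k_pos : (0 : ℝ) < k := Nat.cast_pos.2 (hm.trans hmk)
  have eq_div : runningAverage x k - (m / k * runningAverage x m + (1 - m / k) * b) =
      (∑ i ∈ Finset.Ico m k, x i - ((k - m : ℕ) : ℝ) * b) / k := by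
    rw [runningAverage, runningAverage, Finset.sum_Ico_eq_sub _ hmk, Nat.cast_sub hmk]
    field_simp
    ring
  rwa [eq_div, abs_div, abs_of_pos k_pos, div_le_iff₀ k_pos]

lemma tendsto_runningAverage_sub (hn : StrictMono n) (hn0 : 1 ≤ n 0)
    (hnk : ∀ k, (k + 1) * n k ≤ n (k + 1)) (hε : Tendsto ε atTop (𝓝 0))
    (hb : ∀ k, b k ∈ Set.Icc lo up)
    (h : ∀ᶠ k in atTop, ∀ j ∈ Finset.Icc (n k) (n (k + 1)),
      |∑ i ∈ Finset.Ico (n k) j, x i - ((j - n k : ℕ) : ℝ) * b k| ≤ ε k * j) :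
    Tendsto (fun k => runningAverage x (n (k + 1)) - b k) atTop (𝓝 0) := by
  refine (tendsto_zero_iff_abs_tendsto_zero _).2 (tendsto_zero_of_le_half_add
    (δ := fun k => (up - lo) * (1 / ((k + 1 : ℕ) + 1)) + ε (k + 1)) (fun _ => abs_nonneg _) ?_ ?_)
  · simpa using (((tendsto_add_atTop_iff_nat 1).2
      tendsto_one_div_add_atTop_nhds_zero_nat).const_mul (up - lo)).add
        ((tendsto_add_atTop_iff_nat 1).2 hε)
  filter_upwards [(tendsto_add_atTop_nat 1).eventually h] with k hk
  have one_le : 1 ≤ n (k + 1) := hn0.trans (hn.monotone (Nat.zero_le _))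
  have le_succ : n (k + 1) ≤ n (k + 1 + 1) := hn.monotone (Nat.le_succ _)
  have near := abs_runningAverage_sub_le one_le le_succ (hk _ (Finset.right_mem_Icc.2 le_succ))
  set r : ℝ := n (k + 1) / n (k + 1 + 1)
  have r_nonneg : 0 ≤ r := by positivity
  have r_le : r ≤ 1 / ((k + 1 : ℕ) + 1) := by
    rw [div_le_div_iff₀ (Nat.cast_pos.2 (one_le.trans le_succ)) (by positivity), one_mul, mul_comm]
    exact_mod_cast hnk (k + 1)
  have r_le_half : r ≤ 1 / 2 := r_le.trans <| one_div_le_one_div_of_le two_pos <| by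
    push_cast
    linarith [Nat.cast_nonneg (α := ℝ) k]
  have jump_le : |b k - b (k + 1)| ≤ up - lo := Real.dist_le_of_mem_Icc (hb k) (hb (k + 1))
  calc |runningAverage x (n (k + 1 + 1)) - b (k + 1)|
      = |(runningAverage x (n (k + 1 + 1)) -
            (r * runningAverage x (n (k + 1)) + (1 - r) * b (k + 1)))
          + r * (runningAverage x (n (k + 1)) - b k) + r * (b k - b (k + 1))| := by ring_nf
    _ ≤ ε (k + 1) + r * |runningAverage x (n (k + 1)) - b k| + r * |b k - b (k + 1)| := by
        refine (abs_add_three _ _ _).trans ?_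
        rw [abs_mul, abs_mul, abs_of_nonneg r_nonneg]
        gcongr
    _ ≤ ε (k + 1) + 1 / 2 * |runningAverage x (n (k + 1)) - b k|
          + 1 / ((k + 1 : ℕ) + 1) * (up - lo) := by gcongr
    _ = _ := by simp only [Function.comp_apply]; ring

lemma eventually_runningAverage_mem_Icc (hn : StrictMono n) (hn0 : 1 ≤ n 0)
    (hnk : ∀ k, (k + 1) * n k ≤ n (k + 1)) (hε : Tendsto ε atTop (𝓝 0))
    (hb : ∀ k, b k ∈ Set.Icc lo up)
    (h : ∀ᶠ k in atTop, ∀ j ∈ Finset.Icc (n k) (n (k + 1)),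
      |∑ i ∈ Finset.Ico (n k) j, x i - ((j - n k : ℕ) : ℝ) * b k| ≤ ε k * j)
    {η : ℝ} (hη : 0 < η) :
    ∀ᶠ j in atTop, runningAverage x j ∈ Set.Icc (lo - η) (up + η) := by
  have tendsto_sub := tendsto_runningAverage_sub hn hn0 hnk hε hb h
  obtain ⟨K, hK⟩ := eventually_atTop.1 <| (h.and (hε.eventually_lt_const (half_pos hη))).and <|
    tendsto_sub.eventually (Metric.ball_mem_nhds 0 (half_pos hη))
  filter_upwards [eventually_gt_atTop (n (K + 1))] with j hj
  obtain ⟨k, hkj, hjk⟩ := hn.exists_between_of_tendsto_atTop hn.tendsto_atTop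
    ((hn.monotone (Nat.zero_le _)).trans_lt hj)
  have hKk : K + 1 < k + 1 := hn.lt_iff_lt.1 (hj.trans_le hjk)
  obtain ⟨i, rfl⟩ : ∃ i, k = i + 1 := Nat.exists_eq_add_one_of_ne_zero (by omega)
  have hKi : K ≤ i := by omega
  have one_le : 1 ≤ n (i + 1) := hn0.trans (hn.monotone (Nat.zero_le _))
  have near := abs_le.1 <| abs_runningAverage_sub_le one_le hkj.le <|
    (hK (i + 1) (by omega)).1.1 j (Finset.mem_Icc.2 ⟨hkj.le, hjk⟩)
  have ε_lt := (hK (i + 1) (by omega)).1.2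
  have start_near : |runningAverage x (n (i + 1)) - b i| < η / 2 := by simpa using (hK i hKi).2
  rw [abs_lt] at start_near
  have combination_mem : n (i + 1) / j * runningAverage x (n (i + 1)) +
      (1 - n (i + 1) / j) * b (i + 1) ∈ Set.Icc (lo - η / 2) (up + η / 2) := by
    have ratio_le_one : (n (i + 1) / j : ℝ) ≤ 1 :=
      div_le_one_of_le₀ (Nat.cast_le.2 hkj.le) (Nat.cast_nonneg j)
    refine convex_Icc (𝕜 := ℝ) _ _ ?_ ?_ (by positivity) (sub_nonneg.2 ratio_le_one)
      (add_sub_cancel _ _)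
    · constructor <;> linarith [(hb i).1, (hb i).2]
    · constructor <;> linarith [(hb (i + 1)).1, (hb (i + 1)).2]
  constructor <;> linarith [combination_mem.1, combination_mem.2]

lemma clusterSet_runningAverage_eq_Icc (hn : StrictMono n) (hn0 : 1 ≤ n 0)
    (hnk : ∀ k, (k + 1) * n k ≤ n (k + 1)) (hε : Tendsto ε atTop (𝓝 0))
    (hb : ∀ k, b k ∈ Set.Icc lo up) (hbc : ∀ c ∈ Set.Icc lo up, MapClusterPt c atTop b)
    (h : ∀ᶠ k in atTop, ∀ j ∈ Finset.Icc (n k) (n (k + 1)),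
      |∑ i ∈ Finset.Ico (n k) j, x i - ((j - n k : ℕ) : ℝ) * b k| ≤ ε k * j) :
    clusterSet (runningAverage x) = Set.Icc lo up := by
  refine Set.Subset.antisymm (fun c hc => ?_) fun c hc => ?_
  · have mem_thickening {η : ℝ} (hη : 0 < η) : c ∈ Set.Icc (lo - η) (up + η) :=
      isClosed_Icc.mem_of_mapClusterPt hc (eventually_runningAverage_mem_Icc hn hn0 hnk hε hb h hη)
    exact ⟨le_of_forall_pos_le_add fun η hη => sub_le_iff_le_add.1 (mem_thickening hη).1,
      le_of_forall_pos_le_add fun η hη => (mem_thickening hη).2⟩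
  · obtain ⟨s, hs, hlim⟩ := (hbc c hc).tendsto_subseq
    have tendsto_average := ((tendsto_runningAverage_sub hn hn0 hnk hε hb h).comp
      hs.tendsto_atTop).add hlim
    simp only [Function.comp_def, sub_add_cancel, zero_add] at tendsto_average
    exact .of_comp (hn.tendsto_atTop.comp ((tendsto_add_atTop_nat 1).comp hs.tendsto_atTop))
      tendsto_average.mapClusterPt

lemma clusterSet_runningAverage_eq_Icc_of_tendsto_blockPenalty (hn : StrictMono n) (hn0 : 1 ≤ n 0)
    (hnk : ∀ k, (k + 1) * n k ≤ n (k + 1)) (hε0 : ∀ k, 0 < ε k) (hε : Tendsto ε atTop (𝓝 0))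
    (hb : ∀ k, b k ∈ Set.Icc lo up) (hbc : ∀ c ∈ Set.Icc lo up, MapClusterPt c atTop b)
    {a : ℕ → (ℕ → ℝ) → ℝ} (hab : Tendsto (fun k => a k x - b k) atTop (𝓝 0))
    (h : Tendsto (fun k => blockPenalty (n k) (n (k + 1)) (ε k) (a k) x) atTop (𝓝 0)) :
    clusterSet (runningAverage x) = Set.Icc lo up := by
  refine clusterSet_runningAverage_eq_Icc (ε := fun k => 2 * ε k + |a k x - b k|) hn hn0 hnk
    (by simpa using (hε.const_mul 2).add hab.abs) hb hbc ?_
  filter_upwards [h.eventually_lt_const zero_lt_one] with k hk j hj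
  have near_a := abs_le_of_blockPenalty_lt_one (hn0.trans (hn.monotone (Nat.zero_le k))) (hε0 k)
    hk hj
  have shift_le : |((j - n k : ℕ) : ℝ) * (a k x - b k)| ≤ |a k x - b k| * j := by
    rw [abs_mul, Nat.abs_cast, mul_comm]
    gcongr
    exact Nat.sub_le _ _
  calc |∑ i ∈ Finset.Ico (n k) j, x i - ((j - n k : ℕ) : ℝ) * b k|
      = |(∑ i ∈ Finset.Ico (n k) j, x i - ((j - n k : ℕ) : ℝ) * a k x)
          + ((j - n k : ℕ) : ℝ) * (a k x - b k)| := by ring_nf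
    _ ≤ 2 * ε k * j + |a k x - b k| * j := (abs_add_le _ _).trans (add_le_add near_a shift_le)
    _ = _ := by ring

variable {q f f' : ℕ → ℝ} {l u : ℝ}

lemma add_mul_sub_mem_Icc (hlu : l ≤ u) {t : ℝ} (ht : t ∈ Set.Icc (0 : ℝ) 1) :
    l + t * (u - l) ∈ Set.Icc l u :=
  segment_eq_Icc hlu ▸ segment_eq_image' ℝ l u ▸ Set.mem_image_of_mem _ ht

lemma mapClusterPt_add_mul_sub (hlu : l ≤ u)
    (hq : ∀ t ∈ Set.Icc (0 : ℝ) 1, MapClusterPt t atTop q) {c : ℝ} (hc : c ∈ Set.Icc l u) :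
    MapClusterPt c atTop fun k => l + q k * (u - l) := by
  rw [← segment_eq_Icc hlu, segment_eq_image'] at hc
  obtain ⟨t, ht, rfl⟩ := hc
  exact (hq t ht).continuousAt_comp (f := fun t => l + t • (u - l)) (by fun_prop)

lemma tendsto_clamp_add_mul_sub_sub (hq : ∀ k, q k ∈ Set.Icc (0 : ℝ) 1) (hlo : lo ≤ l)
    (hlu : l ≤ u) (hup : u ≤ up) (hf : Tendsto f atTop (𝓝 l)) (hf' : Tendsto f' atTop (𝓝 u)) :
    Tendsto (fun k => clamp lo up (f k + q k * (f' k - f k)) - (l + q k * (u - l))) atTop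
      (𝓝 0) := by
  refine squeeze_zero_norm (a := fun k => |f k - l| + |f' k - u|) (fun k => ?_) (by
    simpa using (hf.sub_const l).abs.add (hf'.sub_const u).abs)
  obtain ⟨q_nonneg, q_le_one⟩ := hq k
  have target_mem := Set.Icc_subset_Icc hlo hup (add_mul_sub_mem_Icc hlu (hq k))
  calc |clamp lo up (f k + q k * (f' k - f k)) - (l + q k * (u - l))|
      = |clamp lo up (f k + q k * (f' k - f k)) - clamp lo up (l + q k * (u - l))| := by
        rw [clamp_of_mem target_mem]
    _ ≤ |f k + q k * (f' k - f k) - (l + q k * (u - l))| := by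
        simpa [Real.dist_eq] using (lipschitzWith_clamp lo up).dist_le_mul _ _
    _ = |(1 - q k) * (f k - l) + q k * (f' k - u)| := by ring_nf
    _ ≤ (1 - q k) * |f k - l| + q k * |f' k - u| := by
        refine (abs_add_le _ _).trans_eq ?_
        rw [abs_mul, abs_mul, abs_of_nonneg q_nonneg, abs_of_nonneg (sub_nonneg.2 q_le_one)]
    _ ≤ |f k - l| + |f' k - u| := add_le_add
        (mul_le_of_le_one_left (abs_nonneg _) (sub_le_self _ q_nonneg))
        (mul_le_of_le_one_left (abs_nonneg _) q_le_one)

end clusterSet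

namespace SublinearExpectation

variable {Ω : Type*} [MeasurableSpace Ω] {S : SublinearExpectation Ω} {Ps : Set S.Prob}
  {X : ℕ → Ω → ℝ} {Z : Ω → ℝ} {lo up : ℝ}

lemma exists_blockTimes (h : S.tail Z 0 ≠ ⊤) (hmeans : Set.Icc lo up ⊆ closure (S.means Z))
    {ε δ : ℕ → ℝ} (hε : ∀ k, 0 < ε k) (hδ : ∀ k, 0 < δ k) (T : ℕ → ℕ) :
    ∃ n : ℕ → ℕ, StrictMono n ∧ (∀ k, T k ≤ n k) ∧ (∀ k, (k + 1) * n k ≤ n (k + 1)) ∧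
      ∀ k, ∀ a ∈ Set.Icc lo up, ∃ p ∈ S.controlledLaws Z,
        iidLaw p (deviation a (ε k) (n k)) ≤ ENNReal.ofReal (δ k) := by
  choose M hM using fun k => eventually_atTop.1 <| eventually_forall_exists_deviation_le
    (fun _ => integrable_of_mem_controlledLaws h) isCompact_Icc hmeans (hε k)
    (ENNReal.ofReal_pos.2 (hδ k))
  obtain ⟨n, hn, hTn, hnk⟩ := exists_strictMono_seq_ge fun k => max (M k) (T k)
  exact ⟨n, hn, fun k => (le_max_right _ _).trans (hTn k), hnk,
    fun k => hM k _ ((le_max_left _ _).trans (hTn k))⟩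

/-- The block means are `f k + q k * (f' k - f k)`, clamped to `[lo, up]`, with `q` clustering at
all of `[0, 1]`; so they sweep `[l, u]` wherever `f k → l` and `f' k → u`. -/
lemma exists_ae_clusterSet_eq_Icc (hCC : S.ConditionCC Ps) (hX : S.IsIID X)
    (h : S.tail (X 0) 0 ≠ ⊤) (hle : lo ≤ up) (hmeans : Set.Icc lo up ⊆ closure (S.means (X 0)))
    {d d' : ℕ → ℕ} {f f' : ℕ → (ℕ → ℝ) → ℝ} (hf : ∀ k, IsCylLip (d k) (f k))
    (hf' : ∀ k, IsCylLip (d' k) (f' k)) {D : ℕ} {H : ℕ → (ℕ → ℝ) → ℝ}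
    (hH : ∀ K, IsBddCylLip D (H K)) (hH0 : ∀ K x, 0 ≤ H K x) (hHmono : ∀ x, Monotone (H · x))
    {C : ℝ} (hC : ∀ K, -C ≤ S.evSeq X fun x => -H K x) :
    ∃ ν ∈ S.laws Ps X, ∀ᵐ x ∂(ν : Measure (ℕ → ℝ)), BddAbove (Set.range fun K => H K x) ∧
      ∀ l u, lo ≤ l → l ≤ u → u ≤ up → Tendsto (fun k => f k x) atTop (𝓝 l) →
        Tendsto (fun k => f' k x) atTop (𝓝 u) → clusterSet (runningAverage x) = Set.Icc l u := by
  obtain ⟨q, hq, hqc⟩ := exists_seq_forall_mapClusterPt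
  obtain ⟨n, hn, hTn, hnk, hdev⟩ := exists_blockTimes h hmeans
    (ε := fun k => 1 / ((k : ℝ) + 1)) (δ := fun k => (1 / 2) ^ k) (fun k => by positivity)
    (fun k => by positivity) fun k => 1 + d k + d' k + D
  have one_le k : 1 ≤ n k := le_trans (by lia) (hTn k)
  let a (k : ℕ) (x : ℕ → ℝ) : ℝ := clamp lo up (f k x + q k * (f' k x - f k x))
  have isCylLip_a k : IsCylLip (n k) (a k) := by
    have hfk := (hf k).mono (m := n k) (le_trans (by lia) (hTn k))
    have hfk' := (hf' k).mono (m := n k) (le_trans (by lia) (hTn k))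
    exact (hfk.add ((hfk'.sub hfk).const_mul _)).comp_lipschitzWith (lipschitzWith_clamp lo up)
  have exists_law k x : ∃ p ∈ S.dominatedLaws (X 0), ∫ y, blockPenalty (n k) (n (k + 1))
      (1 / ((k : ℝ) + 1)) (a k) (splice (n k) x y) ∂iidLaw p ≤ (1 / 2) ^ k := by
    obtain ⟨p, hp, hpdev⟩ := hdev k (a k x) (clamp_mem_Icc hle _)
    exact ⟨p, hp.1, integral_blockPenalty_splice_le (one_le k) (by positivity)
      (hn.monotone k.le_succ) (isCylLip_a k) (by positivity) x hpdev⟩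
  obtain ⟨ν, hν, hae⟩ := exists_ae_bddAbove_tendsto_zero hCC hX hn.monotone (one_le 0)
    (fun k => isBddCylLip_blockPenalty (hn.monotone k.le_succ) (isCylLip_a k))
    (fun _ => blockPenalty_nonneg) summable_geometric_two (fun k => by positivity) exists_law
    (fun K => (hH K).mono (le_trans (by lia) (hTn 0))) hH0 hHmono hC
  refine ⟨ν, hν, hae.mono fun x hx => ⟨hx.1, fun l u hlo hlu hup hfl hfu => ?_⟩⟩
  exact clusterSet_runningAverage_eq_Icc_of_tendsto_blockPenalty hn (one_le 0) hnk
    (fun k => by positivity) tendsto_one_div_add_atTop_nhds_zero_nat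
    (fun k => add_mul_sub_mem_Icc hlu (hq k)) (fun c hc => mapClusterPt_add_mul_sub hlu hqc hc)
    (tendsto_clamp_add_mul_sub_sub hq hlo hlu hup hfl hfu) hx.2

end SublinearExpectation

lemma ae_tendsto_of_lintegral_enorm_sub_le {α E : Type*} {mα : MeasurableSpace α}
    [NormedAddCommGroup E] {μ : Measure α} {f : ℕ → α → E} {g : α → E}
    (hfg : ∀ k, AEStronglyMeasurable (fun x => g x - f k x) μ) {δ : ℕ → ℝ≥0∞}
    (hδ : ∑' k, δ k ≠ ⊤) (h : ∀ k, ∫⁻ x, ‖g x - f k x‖ₑ ∂μ ≤ δ k) :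
    ∀ᵐ x ∂μ, Tendsto (fun k => f k x) atTop (𝓝 (g x)) := by
  have lintegral_tsum_ne_top : ∫⁻ x, ∑' k, ‖g x - f k x‖ₑ ∂μ ≠ ⊤ := by
    rw [lintegral_tsum fun k => (hfg k).enorm]
    exact ne_top_of_le_ne_top hδ (ENNReal.tsum_le_tsum h)
  filter_upwards [ae_lt_top' (.tsum fun k => (hfg k).enorm) lintegral_tsum_ne_top] with x hx
  refine tendsto_iff_edist_tendsto_0.2 ?_
  simpa only [edist_eq_enorm_sub, enorm_sub_rev] using
    ENNReal.tendsto_atTop_zero_of_tsum_ne_top hx.ne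

lemma exists_lipschitzWith_ae_tendsto {E F : Type*} [NormedAddCommGroup E] [NormedSpace ℝ E]
    [FiniteDimensional ℝ E] [MeasurableSpace E] [BorelSpace E] [NormedAddCommGroup F]
    [NormedSpace ℝ F] {p : Measure E} [IsFiniteMeasureOnCompacts p] {φ : E → F}
    (hφ : Integrable φ p) :
    ∃ h : ℕ → E → F, (∀ k, ∃ K, LipschitzWith K (h k)) ∧
      ∀ᵐ z ∂p, Tendsto (fun k => h k z) atTop (𝓝 (φ z)) := by
  choose h h_supp h_smooth hh using fun k : ℕ =>
    (memLp_one_iff_integrable.2 hφ).exist_eLpNorm_sub_le ENNReal.one_ne_top le_rfl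
      (show (0 : ℝ) < (1 / 2) ^ k by positivity)
  refine ⟨h, fun k => (h_smooth k).lipschitzWith_of_hasCompactSupport (h_supp k) (by simp), ?_⟩
  exact ae_tendsto_of_lintegral_enorm_sub_le (fun k => hφ.aestronglyMeasurable.sub
    (h_smooth k).continuous.aestronglyMeasurable) summable_geometric_two.tsum_ofReal_ne_top
    fun k => by simpa [eLpNorm_one_eq_lintegral_enorm] using hh k

/-- The largest `c`-Lipschitz function `h` with `h ∘ π ≤ ψ` (the Pasch–Hausdorff envelope of `ψ`
along `π`), provided that `ψ` is bounded below. -/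
noncomputable def lipschitzEnvelope {α β : Type*} [PseudoMetricSpace α] (π : β → α) (c : NNReal)
    (ψ : β → ℝ) (z : α) : ℝ :=
  ⨅ y, (ψ y + c * dist z (π y))

section lipschitzEnvelope

variable {α β : Type*} [PseudoMetricSpace α] {π : β → α} {c : NNReal} {ψ : β → ℝ} {M : ℝ}

lemma bddBelow_lipschitzEnvelope (hψ : ∀ y, M ≤ ψ y) (z : α) :
    BddBelow (Set.range fun y => ψ y + c * dist z (π y)) :=
  ⟨M, Set.forall_mem_range.2 fun y => le_add_of_le_of_nonneg (hψ y) (by positivity)⟩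

lemma lipschitzEnvelope_le (hψ : ∀ y, M ≤ ψ y) (y : β) :
    lipschitzEnvelope π c ψ (π y) ≤ ψ y :=
  (ciInf_le (bddBelow_lipschitzEnvelope hψ (π y)) y).trans_eq (by simp)

lemma le_lipschitzEnvelope [Nonempty β] (hψ : ∀ y, M ≤ ψ y) (z : α) :
    M ≤ lipschitzEnvelope π c ψ z :=
  le_ciInf fun y => le_add_of_le_of_nonneg (hψ y) (by positivity)

lemma lipschitzWith_lipschitzEnvelope [Nonempty β] (hψ : ∀ y, M ≤ ψ y) :
    LipschitzWith c (lipschitzEnvelope π c ψ) := by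
  refine .of_le_add_mul _ fun z w => sub_le_iff_le_add.1 (le_ciInf fun y => ?_)
  calc lipschitzEnvelope π c ψ z - c * dist z w
      ≤ ψ y + c * dist z (π y) - c * dist z w := by
        gcongr
        exact ciInf_le (bddBelow_lipschitzEnvelope hψ z) y
    _ ≤ ψ y + c * (dist z w + dist w (π y)) - c * dist z w := by
        gcongr
        exact dist_triangle _ _ _
    _ = ψ y + c * dist w (π y) := by ring

lemma lipschitzEnvelope_mono {α' : Type*} [PseudoMetricSpace α'] {π' : β → α'} {c' : NNReal}
    (hψ : ∀ y, M ≤ ψ y) (hc : c ≤ c') {z : α} {z' : α'}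
    (hπ : ∀ y, dist z (π y) ≤ dist z' (π' y)) :
    lipschitzEnvelope π c ψ z ≤ lipschitzEnvelope π' c' ψ z' :=
  ciInf_mono (bddBelow_lipschitzEnvelope hψ z) fun y => by
    have := hπ y
    gcongr

/-- Near-minimizers of the infimum defining the `n`-th envelope at `π n x` satisfy
`n * dist (π n x) (π n y) = O(1)`, so they are forced towards `x`. -/
lemma tendsto_lipschitzEnvelope [TopologicalSpace β] {α : ℕ → Type*}
    [∀ n, PseudoMetricSpace (α n)] {π : ∀ n, β → α n} {x : β} {M' : ℝ}
    (hπ : ∀ y : ℕ → β, Tendsto (fun n => dist (π n x) (π n (y n))) atTop (𝓝 0) →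
      Tendsto y atTop (𝓝 x))
    (hψ : ContinuousAt ψ x) (hM : ∀ y, M ≤ ψ y) (hM' : ∀ y, ψ y ≤ M') :
    Tendsto (fun n : ℕ => lipschitzEnvelope (π n) n ψ (π n x)) atTop (𝓝 (ψ x)) := by
  have exists_near (n : ℕ) : ∃ y, ψ y + n * dist (π n x) (π n y) <
      lipschitzEnvelope (π n) n ψ (π n x) + 1 / ((n : ℝ) + 1) :=
    haveI : Nonempty β := ⟨x⟩
    exists_lt_of_ciInf_lt (lt_add_of_pos_right _ (by positivity))
  choose y hy using exists_near
  have env_le (n : ℕ) : lipschitzEnvelope (π n) n ψ (π n x) ≤ ψ x := lipschitzEnvelope_le hM x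
  have dist_le (n : ℕ) (hn : 0 < n) :
      dist (π n x) (π n (y n)) ≤ (M' - M + 1) / n := by
    have : 1 / ((n : ℝ) + 1) ≤ 1 := div_le_one_of_le₀ (by simp) (by positivity)
    rw [le_div_iff₀' (by exact_mod_cast hn)]
    linarith [hy n, env_le n, hM (y n), hM' x]
  have tendsto_y : Tendsto y atTop (𝓝 x) := hπ y <|
    squeeze_zero' (.of_forall fun _ => dist_nonneg) ((eventually_gt_atTop 0).mono dist_le)
      (tendsto_const_div_atTop_nhds_zero_nat _)
  have tendsto_lower := (hψ.tendsto.comp tendsto_y).sub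
    (tendsto_one_div_add_atTop_nhds_zero_nat (𝕜 := ℝ))
  rw [sub_zero] at tendsto_lower
  refine tendsto_of_tendsto_of_tendsto_of_le_of_le tendsto_lower tendsto_const_nhds
    (fun n => ?_) env_le
  have : 0 ≤ n * dist (π n x) (π n (y n)) := by positivity
  simp only [Function.comp_apply]
  linarith [hy n]

end lipschitzEnvelope

/-- The `K`-th of a sequence of bounded Lipschitz functions that increases to the indicator of the
open set `U`. -/
noncomputable def openBump {E : Type*} [PseudoEMetricSpace E] (U : Set E) (K : ℕ) (z : E) : ℝ :=
  1 - thickenedIndicator (δ := 1 / (K + 1)) (by positivity) Uᶜ z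

section openBump

variable {E : Type*} {U : Set E} {K : ℕ}

lemma openBump_mem_Icc [PseudoEMetricSpace E] (U : Set E) (K : ℕ) (z : E) :
    openBump U K z ∈ Set.Icc 0 1 :=
  ⟨sub_nonneg.2 (by exact_mod_cast thickenedIndicator_le_one _ _ _), sub_le_self _ (by positivity)⟩

lemma openBump_le_indicator [PseudoEMetricSpace E] (z : E) :
    openBump U K z ≤ U.indicator (fun _ => 1) z := by
  by_cases hz : z ∈ U
  · simpa [hz] using (openBump_mem_Icc U K z).2
  · rw [Set.indicator_of_notMem hz, openBump, thickenedIndicator_one _ _ (Set.mem_compl hz)]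
    simp

lemma monotone_openBump [PseudoEMetricSpace E] (U : Set E) (z : E) :
    Monotone (openBump U · z) := fun _ _ h =>
  sub_le_sub_left (by exact_mod_cast thickenedIndicator_mono _ _ (by gcongr) _ _) _

lemma tendsto_openBump [PseudoEMetricSpace E] (hU : IsOpen U) {z : E} (hz : z ∈ U) :
    Tendsto (openBump U · z) atTop (𝓝 1) := by
  have h := tendsto_pi_nhds.1 (thickenedIndicator_tendsto_indicator_closure
    (fun K : ℕ => by positivity) tendsto_one_div_add_atTop_nhds_zero_nat Uᶜ) z
  rw [hU.isClosed_compl.closure_eq, Set.indicator_of_notMem (by simpa using hz)] at h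
  simpa [openBump] using (NNReal.tendsto_coe.2 h).const_sub 1

lemma isBddLip_openBump [PseudoMetricSpace E] (U : Set E) (K : ℕ) : IsBddLip (openBump U K) :=
  ⟨⟨_, (LipschitzWith.const 1).sub (LipschitzWith.subtype_val _ |>.comp
    (lipschitzWith_thickenedIndicator _ _))⟩, IsBdd.of_mem_Icc (openBump_mem_Icc U K)⟩

lemma integral_openBump_le [PseudoEMetricSpace E] [MeasurableSpace E] [BorelSpace E]
    (p : Measure E) [IsFiniteMeasure p] (hU : IsOpen U) : ∫ z, openBump U K z ∂p ≤ p.real U := by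
  rw [← integral_indicator_one hU.measurableSet]
  refine integral_mono_of_nonneg (.of_forall fun z => (openBump_mem_Icc U K z).1)
    ((integrable_const 1).indicator hU.measurableSet) (.of_forall openBump_le_indicator)

end openBump

lemma isBddLip_sum {E ι : Type*} [PseudoMetricSpace E] {s : Finset ι} {h : ι → E → ℝ}
    (hh : ∀ i ∈ s, IsBddLip (h i)) : IsBddLip fun z => ∑ i ∈ s, h i z := by
  induction s using Finset.cons_induction with
  | empty => simpa only [Finset.sum_empty] using ⟨⟨0, .const 0⟩, IsBdd.const 0⟩
  | cons i s hi ih =>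
    rw [Finset.forall_mem_cons] at hh
    obtain ⟨⟨⟨K, hK⟩, hi_bdd⟩, hs⟩ := hh
    obtain ⟨⟨L, hL⟩, hs_bdd⟩ := ih hs
    simpa only [Finset.sum_cons] using ⟨⟨_, hK.add hL⟩, IsBdd.add hi_bdd hs_bdd⟩

/-- The penalty at `z` increases to the number of sets `U j` containing `z`, where `U j` is an open
neighbourhood of `{z | ¬ Q z}` of measure at most `2⁻ʲ`. -/
lemma exists_isBddLip_penalty {E : Type*} [PseudoMetricSpace E] [MeasurableSpace E] [BorelSpace E]
    {p : Measure E} [IsFiniteMeasure p] {Q : E → Prop} (hQ : ∀ᵐ z ∂p, Q z) :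
    ∃ H : ℕ → E → ℝ, (∀ K, IsBddLip (H K)) ∧ (∀ K z, 0 ≤ H K z) ∧ (∀ z, Monotone (H · z)) ∧
      (∀ K, ∫ z, H K z ∂p ≤ 2) ∧ ∀ z, BddAbove (Set.range (H · z)) → Q z := by
  choose U subset_U isOpen_U measure_U using fun j : ℕ => Set.exists_isOpen_lt_of_lt {z | ¬ Q z}
    (ENNReal.ofReal ((1 / 2) ^ j)) ((ae_iff.1 hQ).trans_lt (by positivity))
  refine ⟨fun K z => ∑ j ∈ Finset.range K, openBump (U j) K z,
    fun K => isBddLip_sum fun j _ => isBddLip_openBump _ _,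
    fun K z => Finset.sum_nonneg fun j _ => (openBump_mem_Icc _ _ _).1,
    fun z K L hKL => ?_, fun K => ?_, fun z ⟨B, hB⟩ => ?_⟩
  · exact (Finset.sum_le_sum fun j _ => monotone_openBump (U j) z hKL).trans
      (Finset.sum_le_sum_of_subset_of_nonneg (Finset.range_mono hKL) fun j _ _ =>
        (openBump_mem_Icc _ _ _).1)
  · have integrable_openBump j : Integrable (openBump (U j) K) p :=
      have ⟨⟨_, hL⟩, hb⟩ := isBddLip_openBump (U j) K
      IsBdd.integrable hb hL.continuous.measurable p
    calc ∫ z, ∑ j ∈ Finset.range K, openBump (U j) K z ∂p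
        = ∑ j ∈ Finset.range K, ∫ z, openBump (U j) K z ∂p :=
          integral_finsetSum _ fun j _ => integrable_openBump j
      _ ≤ ∑ j ∈ Finset.range K, (1 / 2) ^ j := Finset.sum_le_sum fun j _ =>
          (integral_openBump_le p (isOpen_U j)).trans <|
            ENNReal.toReal_le_of_le_ofReal (by positivity) (measure_U j).le
      _ ≤ 2 := sum_geometric_two_le K
  · by_contra hz
    have natCast_le (J : ℕ) : (J : ℝ) ≤ B := by
      have h := tendsto_finsetSum (Finset.range J) fun j _ =>
        tendsto_openBump (isOpen_U j) (subset_U j hz)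
      simp only [Finset.sum_const, Finset.card_range, nsmul_one] at h
      refine le_of_tendsto h ((eventually_ge_atTop J).mono fun K hK => ?_)
      exact (Finset.sum_le_sum_of_subset_of_nonneg (Finset.range_mono hK) fun j _ _ =>
        (openBump_mem_Icc _ _ _).1).trans (hB ⟨K, rfl⟩)
    obtain ⟨J, hJ⟩ := exists_nat_gt B
    exact (natCast_le J).not_gt hJ

lemma tendsto_of_tendsto_dist_head {x : ℕ → ℝ} {y : ℕ → ℕ → ℝ}
    (h : Tendsto (fun n => dist (head n x) (head n (y n))) atTop (𝓝 0)) :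
    Tendsto y atTop (𝓝 x) := by
  refine tendsto_pi_nhds.2 fun i => tendsto_iff_dist_tendsto_zero.2 <|
    squeeze_zero' (.of_forall fun _ => dist_nonneg) ((eventually_gt_atTop i).mono fun n hn => ?_) h
  rw [dist_comm]
  exact dist_le_pi_dist (head n x) (head n (y n)) ⟨i, hn⟩

lemma exists_monotone_isBddCylLip_tendsto (ψ : (ℕ → ℝ) →ᵇ ℝ) :
    ∃ f : ℕ → (ℕ → ℝ) → ℝ, (∀ n, IsBddCylLip n (f n)) ∧ (∀ x, Monotone (f · x)) ∧
      (∀ n x, f n x ≤ ψ x) ∧ ∀ x, Tendsto (f · x) atTop (𝓝 (ψ x)) := by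
  have lower : ∀ x, -‖ψ‖ ≤ ψ x := ψ.neg_norm_le_apply
  have envelope_le (n : ℕ) (x : ℕ → ℝ) : lipschitzEnvelope (head n) n ψ (head n x) ≤ ψ x :=
    lipschitzEnvelope_le lower x
  refine ⟨fun n x => lipschitzEnvelope (head n) n ψ (head n x), fun n => ?_, fun x m n hmn => ?_,
    envelope_le, fun x => ?_⟩
  · exact ⟨⟨_, ⟨_, lipschitzWith_lipschitzEnvelope lower⟩, rfl⟩, .of_mem_Icc fun x =>
      ⟨le_lipschitzEnvelope lower _, (envelope_le n x).trans (ψ.apply_le_norm x)⟩⟩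
  · exact lipschitzEnvelope_mono lower (by gcongr) fun y => (dist_pi_le_iff dist_nonneg).2
      fun i => dist_le_pi_dist (head n x) (head n y) (i.castLE hmn)
  · exact tendsto_lipschitzEnvelope (fun _ => tendsto_of_tendsto_dist_head)
      ψ.continuous.continuousAt lower ψ.apply_le_norm

namespace SublinearExpectation

variable {Ω : Type*} [MeasurableSpace Ω] {S : SublinearExpectation Ω} {Ps : Set S.Prob}
  {X : ℕ → Ω → ℝ} {lo up : ℝ}

/-- Almost everywhere approximation by Lipschitz functions is available for the law of the first
`d` coordinates under one fixed member of the family; the penalty keeps the law constructed in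
`exists_ae_clusterSet_eq_Icc` on the set where that approximation converges. -/
lemma exists_ae_clusterSet_eq_Icc_of_measurable (hCC : S.ConditionCC Ps) (hX : S.IsIID X)
    (h : S.tail (X 0) 0 ≠ ⊤) (hmeans : Set.Icc lo up ⊆ closure (S.means (X 0))) {d : ℕ}
    {φlo φup : (Fin d → ℝ) → ℝ} (hφlo : Measurable φlo) (hφup : Measurable φup)
    (hlo : ∀ z, lo ≤ φlo z) (hle : ∀ z, φlo z ≤ φup z) (hup : ∀ z, φup z ≤ up) :
    ∃ ν ∈ S.laws Ps X, ∀ᵐ x ∂(ν : Measure (ℕ → ℝ)),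
      clusterSet (runningAverage x) = Set.Icc (φlo (head d x)) (φup (head d x)) := by
  have measurable_head := (continuous_head d).measurable
  obtain ⟨ν₀, hν₀⟩ := laws_nonempty hCC hX.mem
  let p : Measure (Fin d → ℝ) := (ν₀ : Measure (ℕ → ℝ)).map (head d)
  have : IsProbabilityMeasure p := Measure.isProbabilityMeasure_map measurable_head.aemeasurable
  have isBdd_φlo : IsBdd φlo := .of_mem_Icc fun z => ⟨hlo z, (hle z).trans (hup z)⟩
  have isBdd_φup : IsBdd φup := .of_mem_Icc fun z => ⟨(hlo z).trans (hle z), hup z⟩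
  obtain ⟨f, hf, hf_ae⟩ := exists_lipschitzWith_ae_tendsto (isBdd_φlo.integrable hφlo p)
  obtain ⟨f', hf', hf'_ae⟩ := exists_lipschitzWith_ae_tendsto (isBdd_φup.integrable hφup p)
  obtain ⟨H, hH, hH0, hHmono, hH_le, hH_bdd⟩ := exists_isBddLip_penalty (hf_ae.and hf'_ae)
  have isBddCylLip_H K : IsBddCylLip d (H K ∘ head d) :=
    ⟨⟨H K, (hH K).1, rfl⟩, IsBdd.comp (hH K).2 _⟩
  have neg_two_le K : -2 ≤ S.evSeq X fun x => -(H K ∘ head d) x := by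
    refine le_trans ?_ (integral_le_evSeq hX.mem (laws_mono (subset_maxFamily hCC) X hν₀)
      (isBddCylLip_H K).neg)
    have ⟨_, hL⟩ := (hH K).1
    rw [integral_neg, neg_le_neg_iff, Function.comp_def,
      ← integral_map measurable_head.aemeasurable hL.continuous.aestronglyMeasurable]
    exact hH_le K
  have hlo_le : lo ≤ up := (hlo 0).trans ((hle 0).trans (hup 0))
  obtain ⟨ν, hν, hae⟩ := exists_ae_clusterSet_eq_Icc hCC hX h hlo_le hmeans
    (fun k => ⟨f k, hf k, rfl⟩) (fun k => ⟨f' k, hf' k, rfl⟩) isBddCylLip_H (fun _ _ => hH0 _ _)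
    (fun x => hHmono (head d x)) neg_two_le
  refine ⟨ν, hν, hae.mono fun x ⟨hx_bdd, hx⟩ => ?_⟩
  obtain ⟨hfx, hfx'⟩ := hH_bdd _ hx_bdd
  exact hx _ _ (hlo _) (hle _) (hup _) hfx hfx'

/-- Dini's theorem: weak compactness takes the place of compactness of the underlying space. -/
lemma exists_forall_integral_le_of_antitone (hCC : S.ConditionCC Ps) (hX : ∀ i, X i ∈ S.H)
    {w : ℕ → (ℕ → ℝ) → ℝ} {n : ℕ → ℕ} (hw : ∀ k, IsBddCylLip (n k) (w k))
    (hanti : ∀ x, Antitone (w · x)) (hlim : ∀ x, Tendsto (w · x) atTop (𝓝 0)) {ε : ℝ}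
    (hε : 0 < ε) :
    ∃ k, ∀ ν ∈ S.laws Ps X, ∫ x, w k x ∂(ν : Measure (ℕ → ℝ)) ≤ ε := by
  by_contra! hcon
  obtain ⟨ν, -, hν⟩ := exists_forall_integral_le hCC hX (fun k => (hw k).neg) (c := fun _ => -ε)
    fun K => by
      obtain ⟨ν, hν, hlt⟩ := hcon K
      refine ⟨ν, hν, fun k hk => ?_⟩
      rw [integral_neg, neg_le_neg_iff]
      exact hlt.le.trans <|
        integral_mono ((hw K).integrable _) ((hw k).integrable _) fun x => hanti x hk
  have tendsto_integral : Tendsto (fun k => ∫ x, w k x ∂(ν : Measure (ℕ → ℝ))) atTop (𝓝 0) := by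
    simpa using integral_tendsto_of_tendsto_of_antitone (fun k => (hw k).integrable _)
      (integrable_zero _ ℝ _) (ae_of_all _ hanti) (ae_of_all (ν : Measure (ℕ → ℝ)) hlim)
  refine hε.not_ge (ge_of_tendsto' tendsto_integral fun k => ?_)
  simpa only [integral_neg, neg_le_neg_iff] using hν k

/-- `ψ` is squeezed between `f n` and `-g n`, and `-g n - f n` decreases to zero. -/
lemma exists_isCylLip_forall_lintegral_le (hCC : S.ConditionCC Ps) (hX : ∀ i, X i ∈ S.H)
    (ψ : (ℕ → ℝ) →ᵇ ℝ) {ε : ℝ} (hε : 0 < ε) :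
    ∃ n f, IsCylLip n f ∧ ∀ ν ∈ S.laws Ps X,
      ∫⁻ x, ‖ψ x - f x‖ₑ ∂(ν : Measure (ℕ → ℝ)) ≤ ENNReal.ofReal ε := by
  obtain ⟨f, hf, hfmono, hf_le, hf_lim⟩ := exists_monotone_isBddCylLip_tendsto ψ
  obtain ⟨g, hg, hgmono, hg_le, hg_lim⟩ := exists_monotone_isBddCylLip_tendsto (-ψ)
  have sub_le n x : ‖ψ x - f n x‖ ≤ -g n x - f n x := by
    rw [Real.norm_of_nonneg (sub_nonneg.2 (hf_le n x))]
    exact sub_le_sub_right (le_neg.2 (hg_le n x)) _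
  have hw n : IsBddCylLip n fun x => -g n x - f n x := (hg n).neg.sub (hf n)
  obtain ⟨n, hn⟩ := exists_forall_integral_le_of_antitone hCC hX hw
    (fun x _ _ hmn => sub_le_sub (neg_le_neg (hgmono x hmn)) (hfmono x hmn))
    (fun x => by simpa using (hg_lim x).neg.sub (hf_lim x)) hε
  refine ⟨n, f n, (hf n).isCylLip, fun ν hν => ?_⟩
  calc ∫⁻ x, ‖ψ x - f n x‖ₑ ∂(ν : Measure (ℕ → ℝ))
      ≤ ∫⁻ x, ENNReal.ofReal (-g n x - f n x) ∂(ν : Measure (ℕ → ℝ)) :=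
        lintegral_mono fun x => by
          rw [← ofReal_norm]
          exact ENNReal.ofReal_le_ofReal (sub_le n x)
    _ = ENNReal.ofReal (∫ x, (-g n x - f n x) ∂(ν : Measure (ℕ → ℝ))) :=
        (ofReal_integral_eq_lintegral_ofReal ((hw n).integrable _)
          (ae_of_all _ fun x => (norm_nonneg _).trans (sub_le n x))).symm
    _ ≤ ENNReal.ofReal ε := ENNReal.ofReal_le_ofReal (hn ν hν)

lemma exists_isCylLip_forall_ae_tendsto (hCC : S.ConditionCC Ps) (hX : ∀ i, X i ∈ S.H)
    {φ : (ℕ → ℝ) → ℝ} (hφ : φ ∈ S.Lc Ps X) :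
    ∃ (d : ℕ → ℕ) (f : ℕ → (ℕ → ℝ) → ℝ), (∀ k, IsCylLip (d k) (f k)) ∧
      ∀ ν ∈ S.laws Ps X, ∀ᵐ x ∂(ν : Measure (ℕ → ℝ)), Tendsto (f · x) atTop (𝓝 (φ x)) := by
  have exists_approx (k : ℕ) : ∃ n f, IsCylLip n f ∧ ∀ ν ∈ S.laws Ps X,
      ∫⁻ x, ‖φ x - f x‖ₑ ∂(ν : Measure (ℕ → ℝ)) ≤
        ENNReal.ofReal ((1 / 2) ^ k) + ENNReal.ofReal ((1 / 2) ^ k) := by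
    have hk : (0 : ℝ) < (1 / 2) ^ k := by positivity
    obtain ⟨ψ, hψ⟩ := hφ.2 _ (ENNReal.ofReal_pos.2 hk)
    obtain ⟨n, f, hf, hfψ⟩ := exists_isCylLip_forall_lintegral_le hCC hX ψ hk
    refine ⟨n, f, hf, fun ν hν => ?_⟩
    have measurable_sub : Measurable fun x => ‖φ x - ψ x‖ₑ :=
      (hφ.1.sub ψ.continuous.measurable).enorm
    have hφψ : ∫⁻ x, ‖φ x - ψ x‖ₑ ∂(ν : Measure (ℕ → ℝ)) ≤ ENNReal.ofReal ((1 / 2) ^ k) := by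
      obtain ⟨P, hP, hνP⟩ := (mem_laws_iff hX).1 hν
      rw [hνP, lintegral_law hX measurable_sub]
      simpa only [Real.enorm_eq_ofReal_abs] using (iSup₂_le_iff.1 hψ) P hP
    calc ∫⁻ x, ‖φ x - f x‖ₑ ∂(ν : Measure (ℕ → ℝ))
        ≤ ∫⁻ x, (‖φ x - ψ x‖ₑ + ‖ψ x - f x‖ₑ) ∂(ν : Measure (ℕ → ℝ)) :=
          lintegral_mono fun x => by simpa using enorm_add_le (φ x - ψ x) (ψ x - f x)
      _ ≤ _ := by
          rw [lintegral_add_left measurable_sub]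
          exact add_le_add hφψ (hfψ ν hν)
  choose d f hf hfφ using exists_approx
  refine ⟨d, f, hf, fun ν hν => ae_tendsto_of_lintegral_enorm_sub_le (fun k =>
    (hφ.1.sub (hf k).measurable).aestronglyMeasurable) ?_ fun k => hfφ k ν hν⟩
  rw [ENNReal.tsum_add]
  exact ENNReal.add_ne_top.2 ⟨summable_geometric_two.tsum_ofReal_ne_top,
    summable_geometric_two.tsum_ofReal_ne_top⟩

lemma exists_ae_clusterSet_eq_Icc_of_mem_Lc (hCC : S.ConditionCC Ps) (hX : S.IsIID X)
    (h : S.tail (X 0) 0 ≠ ⊤) (hmeans : Set.Icc lo up ⊆ closure (S.means (X 0)))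
    {φlo φup : (ℕ → ℝ) → ℝ} (hφlo : φlo ∈ S.Lc Ps X) (hφup : φup ∈ S.Lc Ps X)
    (hlo : ∀ x, lo ≤ φlo x) (hle : ∀ x, φlo x ≤ φup x) (hup : ∀ x, φup x ≤ up) :
    ∃ ν ∈ S.laws Ps X, ∀ᵐ x ∂(ν : Measure (ℕ → ℝ)),
      clusterSet (runningAverage x) = Set.Icc (φlo x) (φup x) := by
  obtain ⟨d, f, hf, hf_ae⟩ := exists_isCylLip_forall_ae_tendsto hCC hX.mem hφlo
  obtain ⟨d', f', hf', hf'_ae⟩ := exists_isCylLip_forall_ae_tendsto hCC hX.mem hφup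
  have hlo_le : lo ≤ up := (hlo 0).trans ((hle 0).trans (hup 0))
  obtain ⟨ν, hν, hae⟩ := exists_ae_clusterSet_eq_Icc hCC hX h hlo_le hmeans hf hf' (D := 0)
    (H := 0) (fun _ => .const 0) (fun _ _ => le_rfl) (fun _ => monotone_const) (C := 0)
    (fun _ => by simp [evSeq, ev_const])
  refine ⟨ν, hν, ?_⟩
  filter_upwards [hae, hf_ae ν hν, hf'_ae ν hν] with x hx hfx hf'x
  exact hx.2 _ _ (hlo x) (hle x) (hup x) hfx hf'x

lemma exists_outerCapacity_eq_one_of_ae (hPs : Ps ⊆ S.maxFamily) {p : (ℕ → ℝ) → Prop}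
    (h : ∃ ν ∈ S.laws Ps X, ∀ᵐ x ∂(ν : Measure (ℕ → ℝ)), p x) :
    ∃ P ∈ Ps, S.outerCapacity {ω | p fun i => X i ω} = 1 ∧
      (P : @Measure Ω S.sigma) {ω | p fun i => X i ω} = 1 :=
  have ⟨_, hν, hp⟩ := h
  have ⟨P, hP, hP1⟩ := exists_measure_eq_one_of_ae hν hp
  ⟨P, hP, outerCapacity_eq_one (hPs hP) hP1, hP1⟩

end SublinearExpectation

theorem theorem2p3 {Ω : Type*} [MeasurableSpace Ω] (S : SublinearExpectation Ω)
    (Ps : Set S.Prob) (hCC : S.ConditionCC Ps)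
    (X : ℕ → Ω → ℝ) (hX : S.IsIID X) (hmoment : S.choquet (fun ω => |X 0 ω|) < ⊤) :
    (∀ (d : ℕ) (φlo φup : (Fin d → ℝ) → ℝ), Measurable φlo → Measurable φup →
      (∀ x, S.lowerMean (X 0) ≤ (φlo x : EReal)) → (∀ x, φlo x ≤ φup x) →
      (∀ x, (φup x : EReal) ≤ S.upperMean (X 0)) →
      ∃ Q ∈ S.maxFamily,
        S.outerCapacity {ω | clusterSet (runningAverage (fun i => X i ω)) =
          Set.Icc (φlo (fun j : Fin d => X j ω)) (φup (fun j : Fin d => X j ω))} = 1 ∧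
        (Q : @Measure Ω S.sigma) {ω | clusterSet (runningAverage (fun i => X i ω)) =
          Set.Icc (φlo (fun j : Fin d => X j ω)) (φup (fun j : Fin d => X j ω))} = 1) ∧
    (∀ φlo ∈ S.Lc Ps X, ∀ φup ∈ S.Lc Ps X,
      (∀ x, S.lowerMean (X 0) ≤ (φlo x : EReal)) → (∀ x, φlo x ≤ φup x) →
      (∀ x, (φup x : EReal) ≤ S.upperMean (X 0)) →
      ∃ P ∈ Ps,
        S.outerCapacity {ω | clusterSet (runningAverage (fun i => X i ω)) =
          Set.Icc (φlo (fun i => X i ω)) (φup (fun i => X i ω))} = 1 ∧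
        (P : @Measure Ω S.sigma) {ω | clusterSet (runningAverage (fun i => X i ω)) =
          Set.Icc (φlo (fun i => X i ω)) (φup (fun i => X i ω))} = 1) := by
  have hPs := SublinearExpectation.subset_maxFamily hCC
  have tail_ne_top := SublinearExpectation.tail_zero_ne_top hmoment
  have hmeans := SublinearExpectation.Icc_subset_closure_means hCC (hX.mem 0) tail_ne_top
  rw [SublinearExpectation.lowerMean_eq_sInf_means hCC (hX.mem 0) tail_ne_top,
    SublinearExpectation.upperMean_eq_sSup_means hCC (hX.mem 0) tail_ne_top]
  simp only [EReal.coe_le_coe_iff]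
  constructor
  · intro d φlo φup hφlo hφup hlo hle hup
    obtain ⟨P, hP, h⟩ := SublinearExpectation.exists_outerCapacity_eq_one_of_ae hPs <|
      SublinearExpectation.exists_ae_clusterSet_eq_Icc_of_measurable hCC hX tail_ne_top hmeans
        hφlo hφup hlo hle hup
    exact ⟨P, hPs hP, h⟩
  · intro φlo hφlo φup hφup hlo hle hup
    obtain ⟨P, hP, h⟩ := SublinearExpectation.exists_outerCapacity_eq_one_of_ae hPs <|
      SublinearExpectation.exists_ae_clusterSet_eq_Icc_of_mem_Lc hCC hX tail_ne_top hmeans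
        hφlo hφup hlo hle hup
    exact ⟨P, hP, h⟩
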